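/- Let $(M,g)$ be a smooth Riemannian manifold with Levi-Civita connection $\nabla$ and curvature $R_{XY}Z=\nabla_X\nabla_YZ-\nabla_Y\nabla_XZ-\nabla_{[X,Y]}Z$, and let $\tau:T(M)\to M$ be its tangent bundle. For a vector field $X$ on $M$ let $X^H$ and $X^V$ denote its horizontal (with respect to $\nabla$) and vertical lifts to $T(M)$; the same notation is used for the lifts of a tangent vector $w\in T_pM$ to a point $u\in T_pM$. For $u\in T(M)$ put $t=\frac12 g_{\tau(u)}(u,u)$. Let $a,b:[0,\infty)\to\mathbb R$ be smooth with $a(t)>0$ and $a(t)+2tb(t)>0$ for all $t\ge0$ (for instance $a>0$, $b\ge0$), and let $g_A$ be the Riemannian metric on $T(M)$ given at $u$, $p=\tau(u)$, by $$g_A(X^H,Y^H)=g_p(X,Y),\qquad g_A(X^H,Y^V)=0,\qquad g_A(X^V,Y^V)=a(t)g_p(X,Y)+b(t)g_p(X,u)g_p(Y,u).$$ Then the Levi-Civita connection $\tilde\nabla$ of $g_A$ satisfies, for all smooth vector fields $X,Y$ on $M$ and at every point $u\in T(M)$ (with $a,b$ and their derivatives evaluated at $t$), $$\tilde\nabla_{X^H}Y^H=(\nabla_XY)^H-\tfrac12(R_{XY}u)^V,$$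 $$\tilde\nabla_{X^H}Y^V=(\nabla_XY)^V+\tfrac a2(R_{uY}X)^H,$$ $$\tilde\nabla_{X^V}Y^H=\tfrac a2(R_{uX}Y)^H,$$ $$\tilde\nabla_{X^V}Y^V=L\bigl(g(X,u)Y^V+g(Y,u)X^V\bigr)+M\,g(X,Y)u^V+N\,g(X,u)g(Y,u)u^V,$$ where $$L=\frac{a'(t)}{2a(t)},\qquad M=\frac{2b(t)-a'(t)}{2(a(t)+2tb(t))},\qquad N=\frac{a(t)b'(t)-2a'(t)b(t)}{2a(t)(a(t)+2tb(t))}.$$ -/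

import Mathlib

open Bundle Manifold Set
open scoped ContDiff Topology

noncomputable section

section LeviCivita

variable {E : Type*} [NormedAddCommGroup E] [NormedSpace ℝ E]
  {H : Type*} [TopologicalSpace H] {I : ModelWithCorners ℝ E H}
  {M : Type*} [TopologicalSpace M] [ChartedSpace H M] [IsManifold I 1 M]

/-- The connection `cov` is the Levi-Civita connection of the metric tensor `G`: it is a smooth
connection, it is torsion free, `∇_X Y - ∇_Y X = [X, Y]`, and it is compatible with the metric,
`v (G(Y, Z)) = G(∇_v Y, Z) + G(Y, ∇_v Z)`. In Mathlib's convention `cov Y p v` is `∇_v Y`. -/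
structure IsLeviCivita (G : Π p : M, TangentSpace I p → TangentSpace I p → ℝ)
    (cov : CovariantDerivative I E (TangentSpace I : M → Type _)) : Prop where
  smooth : cov.ContMDiffCovariantDerivative ∞
  torsion_free : ∀ (X Y : Π p : M, TangentSpace I p) (p : M),
    MDifferentiableAt I I.tangent (fun q => (⟨q, X q⟩ : TangentBundle I M)) p →
    MDifferentiableAt I I.tangent (fun q => (⟨q, Y q⟩ : TangentBundle I M)) p →
    cov Y p (X p) - cov X p (Y p) = VectorField.mlieBracket I X Y p
  metric : ∀ (Y Z : Π p : M, TangentSpace I p) (p : M) (v : TangentSpace I p),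
    MDifferentiableAt I I.tangent (fun q => (⟨q, Y q⟩ : TangentBundle I M)) p →
    MDifferentiableAt I I.tangent (fun q => (⟨q, Z q⟩ : TangentBundle I M)) p →
    mvfderiv I (fun q => G q (Y q) (Z q)) p v = G p (cov Y p v) (Z p) + G p (Y p) (cov Z p v)

/-- The curvature `R_{xy} z = ∇_X ∇_Y Z - ∇_Y ∇_X Z - ∇_{[X, Y]} Z` at `p`, where `X`, `Y`, `Z` are
vector fields, smooth near `p`, with the values `x`, `y`, `z` at `p` (the value does not depend on
their choice; `FiberBundle.extend` takes the fields that are constant in the chart at `p`). -/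
def curvature (cov : CovariantDerivative I E (TangentSpace I : M → Type _)) (p : M)
    (x y z : TangentSpace I p) : TangentSpace I p :=
  let X : Π q : M, TangentSpace I q := FiberBundle.extend E x
  let Y : Π q : M, TangentSpace I q := FiberBundle.extend E y
  let Z : Π q : M, TangentSpace I q := FiberBundle.extend E z
  cov (fun q => cov Z q (Y q)) p x - cov (fun q => cov Z q (X q)) p y
    - cov Z p (VectorField.mlieBracket I X Y p)

end LeviCivita

section Lifts

variable {E : Type*} [NormedAddCommGroup E] [NormedSpace ℝ E]
  {H : Type*} [TopologicalSpace H] {I : ModelWithCorners ℝ E H}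
  {M : Type*} [TopologicalSpace M] [ChartedSpace H M] [IsManifold I ∞ M]

/-- The vertical lift `w^V` at `u`: the derivative at `u`, in the direction `w`, of the inclusion of
the fibre through `u`, `v ↦ (p, v)` with `p = τ(u)`. (In Mathlib the vector space `T_p M` is `E`.) -/
def verticalLift (u : TangentBundle I M) (w : TangentSpace I u.proj) : TangentSpace I.tangent u :=
  mfderiv 𝓘(ℝ, E) I.tangent (fun v : E => (⟨u.proj, v⟩ : TangentBundle I M)) u.snd w

/-- The horizontal lift `v^H` at `u`: for a vector field `σ`, smooth near `p = τ(u)`, with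
`σ(p) = u` it is `dσ(v) - (∇_v σ)^V`. For the field `σ` that is constant in the chart at `p` this
reads `∂_i^H = ∂/∂x^i - Γ_{ij}^k u^j ∂/∂y^k`. -/
def horizontalLift (cov : CovariantDerivative I E (TangentSpace I : M → Type _))
    (u : TangentBundle I M) (v : TangentSpace I u.proj) : TangentSpace I.tangent u :=
  let σ : Π q : M, TangentSpace I q := FiberBundle.extend E u.snd
  let dσ : TangentSpace I.tangent u :=
    mfderiv I I.tangent (fun q => (⟨q, σ q⟩ : TangentBundle I M)) u.proj v
  dσ - verticalLift u (cov σ u.proj v)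

/-- The connection map `K : T_u TM → T_p M`, `p = τ(u)`; in the chart at `p` it sends
`ξ^i ∂/∂x^i + η^k ∂/∂y^k` to `(η^k + Γ_{ij}^k ξ^i u^j) ∂_k`. Thus `K ξ` is the vector whose vertical
lift is the vertical part of `ξ`. -/
def connectionMap (cov : CovariantDerivative I E (TangentSpace I : M → Type _))
    (u : TangentBundle I M) : TangentSpace I.tangent u →L[ℝ] TangentSpace I u.proj :=
  let e := trivializationAt E (TangentSpace I : M → Type _) u.proj
  (e.symmL ℝ u.proj).comp (mvfderiv I.tangent (fun q : TangentBundle I M => (e q).2) u)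
    + (cov (FiberBundle.extend E u.snd) u.proj).comp
        (mfderiv I.tangent I (TotalSpace.proj : TangentBundle I M → M) u)

theorem trivializationAt_fibre (p : M) :
    (fun v : E => (trivializationAt E (TangentSpace I : M → Type _) p
      (⟨p, v⟩ : TangentBundle I M)).2) =
    ((trivializationAt E (TangentSpace I : M → Type _) p).continuousLinearMapAt ℝ p :
      E →L[ℝ] E) := by
  ext v
  exact (congrFun (Trivialization.coe_linearMapAt_of_mem (R := ℝ)
    (trivializationAt E (TangentSpace I : M → Type _) p)
    (FiberBundle.mem_baseSet_trivializationAt' p)) (v : TangentSpace I p)).symm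

theorem mdifferentiableAt_fibre (p : M) (z : E) :
    MDifferentiableAt 𝓘(ℝ, E) I.tangent (fun v : E => (⟨p, v⟩ : TangentBundle I M)) z := by
  refine (mdifferentiableAt_totalSpace I (F := E) (E := (TangentSpace I : M → Type _)) _).2
    ⟨mdifferentiableAt_const, ?_⟩
  exact trivializationAt_fibre (I := I) p ▸
    (ContinuousLinearMap.differentiableAt _).mdifferentiableAt

theorem mdifferentiableAt_trivializationAt (u : TangentBundle I M) :
    MDifferentiableAt I.tangent 𝓘(ℝ, E) (fun q : TangentBundle I M =>
      (trivializationAt E (TangentSpace I : M → Type _) u.proj q).2) u :=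
  ((mdifferentiableAt_totalSpace I (F := E) (E := (TangentSpace I : M → Type _))
    (id : TangentBundle I M → _) (x₀ := u)).1 mdifferentiableAt_id).2

theorem mfderiv_proj_fibre (p : M) (z w : E) :
    mfderiv I.tangent I (TotalSpace.proj : TangentBundle I M → M) ⟨p, z⟩
      (mfderiv 𝓘(ℝ, E) I.tangent (fun v : E => (⟨p, v⟩ : TangentBundle I M)) z w) = 0 := by
  have h := mfderiv_comp (I := 𝓘(ℝ, E)) (I' := I.tangent) (I'' := I) (x := z)
    (g := (TotalSpace.proj : TangentBundle I M → M))
    (f := (fun v : E => (⟨p, v⟩ : TangentBundle I M))) (mdifferentiableAt_proj _)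
    (mdifferentiableAt_fibre p z)
  have h1 := (mfderiv_const (I := 𝓘(ℝ, E)) (I' := I) (x := z) (c := p)).symm.trans h
  exact (DFunLike.congr_fun h1 w).symm

theorem mfderiv_trivializationAt_fibre (p : M) (z w : E) :
    mvfderiv I.tangent (fun q : TangentBundle I M =>
        (trivializationAt E (TangentSpace I : M → Type _) p q).2) ⟨p, z⟩
      (mfderiv 𝓘(ℝ, E) I.tangent (fun v : E => (⟨p, v⟩ : TangentBundle I M)) z w) =
    ((trivializationAt E (TangentSpace I : M → Type _) p).continuousLinearMapAt ℝ p :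
      E →L[ℝ] E) w := by
  have h := mfderiv_comp (I := 𝓘(ℝ, E)) (I' := I.tangent) (I'' := 𝓘(ℝ, E)) (x := z)
    (g := fun q : TangentBundle I M => (trivializationAt E (TangentSpace I : M → Type _) p q).2)
    (f := (fun v : E => (⟨p, v⟩ : TangentBundle I M)))
    (mdifferentiableAt_trivializationAt (⟨p, z⟩ : TangentBundle I M)) (mdifferentiableAt_fibre p z)
  have h5 : mfderiv 𝓘(ℝ, E) 𝓘(ℝ, E) ((fun q : TangentBundle I M =>
      (trivializationAt E (TangentSpace I : M → Type _) p q).2) ∘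
        (fun v : E => (⟨p, v⟩ : TangentBundle I M))) z =
      ((trivializationAt E (TangentSpace I : M → Type _) p).continuousLinearMapAt ℝ p :
        E →L[ℝ] E) := by
    have h2 := trivializationAt_fibre (I := I) p
    rw [Function.comp_def, h2]
    exact mfderiv_eq_fderiv.trans (ContinuousLinearMap.fderiv _)
  exact (DFunLike.congr_fun (h5.symm.trans h) w).symm

theorem mfderiv_proj_verticalLift (u : TangentBundle I M) (w : TangentSpace I u.proj) :
    mfderiv I.tangent I (TotalSpace.proj : TangentBundle I M → M) u (verticalLift u w) = 0 :=
  mfderiv_proj_fibre (E := E) u.proj u.snd w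

theorem connectionMap_verticalLift (cov : CovariantDerivative I E (TangentSpace I : M → Type _))
    (u : TangentBundle I M) (w : TangentSpace I u.proj) :
    connectionMap cov u (verticalLift u w) = w := by
  have h4 := mfderiv_proj_verticalLift u w
  simp only [connectionMap, add_apply, ContinuousLinearMap.comp_apply, h4,
    map_zero, add_zero]
  exact (congrArg ((trivializationAt E (TangentSpace I : M → Type _) u.proj).symmL ℝ u.proj)
    (mfderiv_trivializationAt_fibre (E := E) u.proj u.snd w)).trans
    (Trivialization.symmL_continuousLinearMapAt _
      (FiberBundle.mem_baseSet_trivializationAt' u.proj) w)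

theorem mfderiv_proj_horizontalLift (cov : CovariantDerivative I E (TangentSpace I : M → Type _))
    (u : TangentBundle I M) (v : TangentSpace I u.proj) :
    mfderiv I.tangent I (TotalSpace.proj : TangentBundle I M → M) u (horizontalLift cov u v) =
      v := by
  have h := mfderiv_comp (I := I) (I' := I.tangent) (I'' := I) (x := u.proj)
    (g := (TotalSpace.proj : TangentBundle I M → M))
    (f := (fun q : M => (⟨q, FiberBundle.extend E u.snd q⟩ : TangentBundle I M)))
    (mdifferentiableAt_proj _) (FiberBundle.mdifferentiableAt_extend I E u.snd)
  have h1 := (mfderiv_id (I := I) (x := u.proj)).symm.trans h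
  have h3 := (DFunLike.congr_fun h1 v).symm
  have h4 := mfderiv_proj_verticalLift u (cov (FiberBundle.extend E u.snd) u.proj v)
  have key : (⟨u.proj, FiberBundle.extend E u.snd u.proj⟩ : TangentBundle I M) = u := by
    rw [FiberBundle.extend_apply_self]
  have h5 : (mfderiv I.tangent I (TotalSpace.proj : TangentBundle I M → M) u : E × E →L[ℝ] E)
      = mfderiv I.tangent I (TotalSpace.proj : TangentBundle I M → M)
        (⟨u.proj, FiberBundle.extend E u.snd u.proj⟩ : TangentBundle I M) := by
    rw [key]
  refine (map_sub (mfderiv I.tangent I (TotalSpace.proj : TangentBundle I M → M) u) _ _).trans ?_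
  rw [h4, sub_zero]
  exact (DFunLike.congr_fun h5 _).trans h3

theorem connectionMap_horizontalLift (cov : CovariantDerivative I E (TangentSpace I : M → Type _))
    (u : TangentBundle I M) (v : TangentSpace I u.proj) :
    connectionMap cov u (horizontalLift cov u v) = 0 := by
  let e := trivializationAt E (TangentSpace I : M → Type _) u.proj
  have hp : u.proj ∈ e.baseSet := FiberBundle.mem_baseSet_trivializationAt' u.proj
  have key : (⟨u.proj, FiberBundle.extend E u.snd u.proj⟩ : TangentBundle I M) = u := by
    rw [FiberBundle.extend_apply_self]
  let dσ : TangentSpace I.tangent u := mfderiv I I.tangent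
    (fun q => (⟨q, FiberBundle.extend E u.snd q⟩ : TangentBundle I M)) u.proj v
  have h := mfderiv_comp (I := I) (I' := I.tangent) (I'' := 𝓘(ℝ, E)) (x := u.proj)
    (g := fun q : TangentBundle I M => (e q).2)
    (f := (fun q : M => (⟨q, FiberBundle.extend E u.snd q⟩ : TangentBundle I M)))
    (by rw [key]; exact mdifferentiableAt_trivializationAt u)
    (FiberBundle.mdifferentiableAt_extend I E u.snd)
  have h1 : mfderiv I 𝓘(ℝ, E) ((fun q : TangentBundle I M => (e q).2) ∘
      (fun q : M => (⟨q, FiberBundle.extend E u.snd q⟩ : TangentBundle I M))) u.proj = 0 := by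
    let c : E := (e u).2
    have h2 : ((fun q : TangentBundle I M => (e q).2) ∘
      (fun q : M => (⟨q, FiberBundle.extend E u.snd q⟩ : TangentBundle I M)))
        =ᶠ[𝓝 u.proj] (fun _ : M => c) := by
      filter_upwards [e.open_baseSet.mem_nhds hp] with q hq
      have h3 : (e ⟨q, e.symm q c⟩).2 = c := by rw [e.apply_mk_symm hq c]
      exact h3
    exact h2.mfderiv_eq.trans mfderiv_const
  have h5 : (mvfderiv I.tangent (fun q : TangentBundle I M => (e q).2) u : E × E →L[ℝ] E)
      = mfderiv I.tangent 𝓘(ℝ, E) (fun q : TangentBundle I M => (e q).2)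
        (⟨u.proj, FiberBundle.extend E u.snd u.proj⟩ : TangentBundle I M) := by
    rw [key]; rfl
  have h6 : mvfderiv I.tangent (fun q : TangentBundle I M => (e q).2) u dσ = 0 :=
    (DFunLike.congr_fun h5 _).trans (DFunLike.congr_fun (h.symm.trans h1) v)
  have h7 := mfderiv_proj_horizontalLift cov u v
  have h8 : connectionMap cov u dσ = cov (FiberBundle.extend E u.snd) u.proj v := by
    have h9 := mfderiv_proj_verticalLift u (cov (FiberBundle.extend E u.snd) u.proj v)
    have h10 : mfderiv I.tangent I (TotalSpace.proj : TangentBundle I M → M) u dσ = v := by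
      have h11 := (map_sub (mfderiv I.tangent I (TotalSpace.proj : TangentBundle I M → M) u) dσ
        (verticalLift u (cov (FiberBundle.extend E u.snd) u.proj v))).symm.trans h7
      rwa [h9, sub_zero] at h11
    simp only [connectionMap, add_apply, ContinuousLinearMap.comp_apply, h10]
    refine (congrArg (· + _) ((congrArg (e.symmL ℝ u.proj) h6).trans (map_zero _))).trans ?_
    exact zero_add _
  refine (map_sub (connectionMap cov u) dσ _).trans ?_
  rw [h8, connectionMap_verticalLift, sub_self]

/-- The metric `g_A` on `TM` determined by the functions `a`, `b`: with `t = g(u, u) / 2`,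
`g_A(ξ, η) = g(dτ ξ, dτ η) + a(t) g(K ξ, K η) + b(t) g(K ξ, u) g(K η, u)` at `u`. -/
def gA (g : ContMDiffRiemannianMetric I ∞ E (TangentSpace I : M → Type _))
    (cov : CovariantDerivative I E (TangentSpace I : M → Type _)) (a b : ℝ → ℝ)
    (u : TangentBundle I M) (ξ η : TangentSpace I.tangent u) : ℝ :=
  let gp := g.inner u.proj
  let t : ℝ := gp u.snd u.snd / 2
  let dτ := mfderiv I.tangent I (TotalSpace.proj : TangentBundle I M → M) u
  let K := connectionMap cov u
  gp (dτ ξ) (dτ η) + a t * gp (K ξ) (K η) + b t * (gp (K ξ) u.snd * gp (K η) u.snd)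

section

variable (g : ContMDiffRiemannianMetric I ∞ E (TangentSpace I : M → Type _))
  (cov : CovariantDerivative I E (TangentSpace I : M → Type _)) (a b : ℝ → ℝ)
  (u : TangentBundle I M) (x y : TangentSpace I u.proj)

theorem gA_horizontalLift_horizontalLift :
    gA g cov a b u (horizontalLift cov u x) (horizontalLift cov u y) = g.inner u.proj x y := by
  simp [gA, mfderiv_proj_horizontalLift, connectionMap_horizontalLift]

theorem gA_horizontalLift_verticalLift :
    gA g cov a b u (horizontalLift cov u x) (verticalLift u y) = 0 := by
  simp [gA, mfderiv_proj_verticalLift, connectionMap_horizontalLift]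

theorem gA_verticalLift_verticalLift :
    gA g cov a b u (verticalLift u x) (verticalLift u y) =
      a (g.inner u.proj u.snd u.snd / 2) * g.inner u.proj x y
      + b (g.inner u.proj u.snd u.snd / 2)
        * (g.inner u.proj x u.snd * g.inner u.proj y u.snd) := by
  simp [gA, mfderiv_proj_verticalLift, connectionMap_verticalLift]

end

end Lifts

end

/-! The Koszul formula determines `2 g_A(∇̃_A B, C)` from derivatives of the functions `g_A(A, B)`
and from Lie brackets. Every tangent vector of `TM` at `u` is the value of a field `Z^H + W^V` with
smooth `Z`, `W` (`exists_isLiftSum`), and `g_A` is nondegenerate (`eq_of_forall_gA`), so it suffices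
to evaluate the formula on such sums of lifts (`IsLiftSum`).

The derivatives reduce to those of three kinds of functions on `TM`: `g(S, T) ∘ π`, the fibrewise
linear `v ↦ g(Z, v)`, and `f(g(v, v) / 2)`. Metric compatibility gives them in terms of `dπ` and the
connection map `K` (`IsLeviCivita.mvfderiv_inner_snd`, `IsLeviCivita.mvfderiv_inner_snd_snd`). In
particular `t` is constant along horizontal vectors.

For brackets of `A = X^H + Y^V` and `B = X'^H + Y'^V`, π-relatedness gives `dπ [A, B] = [X, X']`.
Applying the commutator to `v ↦ g(Z, v)` gives `K [A, B] = ∇_X Y' - ∇_{X'} Y - R_{XX'} u`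
(`IsLiftSum.connectionMap_mlieBracket`). This is the only source of curvature. The pair symmetry
`g(R_{xy} z, w) = g(R_{zw} x, y)` then turns the terms paired with a horizontal test field into
`R_{uY'} X` and `R_{uY} X'`.

The result is the single formula `IsLiftSum.leviCivita_gA` for `∇̃_A B`, in which `L`, `M`, `N`
solve a triangular linear system. The four claims are its special cases with vanishing components.
-/

/-! ### Vector fields in charts and the commutator identity for Lie brackets. -/

section VectorFieldsOnManifolds

variable {E : Type*} [NormedAddCommGroup E] [NormedSpace ℝ E]
  {H : Type*} [TopologicalSpace H] {I : ModelWithCorners ℝ E H}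
  {M : Type*} [TopologicalSpace M] [ChartedSpace H M]
  {F : Type*} [NormedAddCommGroup F] [NormedSpace ℝ F]

/-- The Lie bracket acts on twice differentiable functions as a commutator. -/
theorem fderiv_lieBracket {f : E → F} {V W : E → E} {x : E} (hf : ContDiffAt ℝ 2 f x)
    (hV : DifferentiableAt ℝ V x) (hW : DifferentiableAt ℝ W x) :
    fderiv ℝ f x (VectorField.lieBracket ℝ V W x) =
      fderiv ℝ (fun y => fderiv ℝ f y (W y)) x (V x)
        - fderiv ℝ (fun y => fderiv ℝ f y (V y)) x (W x) := by
  have h1 : DifferentiableAt ℝ (fderiv ℝ f) x :=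
    (hf.fderiv_right (m := 1) (by norm_num)).differentiableAt (by norm_num)
  -- Symmetry of the second derivative cancels the terms of second order in `f`, leaving only
  -- derivatives of `V` and `W`.
  have hs : IsSymmSndFDerivAt ℝ f x := hf.isSymmSndFDerivAt (by simp)
  rw [fderiv_clm_apply h1 hW, fderiv_clm_apply h1 hV]
  simp only [VectorField.lieBracket, map_sub, add_apply,
    ContinuousLinearMap.comp_apply, ContinuousLinearMap.flip_apply]
  rw [hs.eq (V x) (W x)]
  abel

/-- Chain rule: the pullback applies the inverse of the derivative of the inverse chart, which
cancels the factor produced by differentiating `f ∘ (extChartAt I x).symm`. This carries the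
commutator identity from the model space to `M`. -/
theorem mvfderiv_apply_extChartAt_symm [I.Boundaryless] [IsManifold I 2 M] {f : M → F} {x : M}
    (V : Π q : M, TangentSpace I q) {y : E} (hy : y ∈ (extChartAt I x).target)
    (hf : MDifferentiableAt I 𝓘(ℝ, F) f ((extChartAt I x).symm y)) :
    fderiv ℝ (f ∘ (extChartAt I x).symm) y
        (VectorField.mpullbackWithin 𝓘(ℝ, E) I (extChartAt I x).symm V (range I) y) =
      mvfderiv I f ((extChartAt I x).symm y) (V ((extChartAt I x).symm y)) := by
  have : IsManifold I 1 M := .of_le (n := 2) (by norm_num)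
  have hd : MDifferentiableAt 𝓘(ℝ, E) I (extChartAt I x).symm y := by
    have := mdifferentiableWithinAt_extChartAt_symm (I := I) hy
    rwa [I.range_eq_univ, mdifferentiableWithinAt_univ] at this
  have hi := isInvertible_mfderivWithin_extChartAt_symm (I := I) hy
  have h := mfderiv_comp (I := 𝓘(ℝ, E)) (I' := I) (I'' := 𝓘(ℝ, F)) y hf hd
  rw [mfderiv_eq_fderiv] at h
  refine (DFunLike.congr_fun h _).trans ?_
  have h2 := hi.self_apply_inverse (V ((extChartAt I x).symm y))
  have h3 : mfderivWithin 𝓘(ℝ, E) I (extChartAt I x).symm (range I) y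
    = mfderiv 𝓘(ℝ, E) I (extChartAt I x).symm y := by
    rw [I.range_eq_univ, mfderivWithin_univ]
  rw [VectorField.mpullbackWithin_apply]
  refine congrArg (mfderiv I 𝓘(ℝ, F) f ((extChartAt I x).symm y)) ?_
  refine Eq.trans ?_ h2
  exact (DFunLike.congr_fun h3 _).symm

/-- The Lie bracket acts on twice differentiable functions as a commutator. -/
theorem mvfderiv_mlieBracket [CompleteSpace E] [I.Boundaryless] [IsManifold I 2 M]
    {f : M → F} {V W : Π q : M, TangentSpace I q} {x : M}
    (hf : ContMDiffAt I 𝓘(ℝ, F) 2 f x)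
    (hV : MDifferentiableAt I I.tangent (fun q => (⟨q, V q⟩ : TangentBundle I M)) x)
    (hW : MDifferentiableAt I I.tangent (fun q => (⟨q, W q⟩ : TangentBundle I M)) x) :
    mvfderiv I f x (VectorField.mlieBracket I V W x) =
      mvfderiv I (fun q => mvfderiv I f q (W q)) x (V x)
        - mvfderiv I (fun q => mvfderiv I f q (V q)) x (W x) := by
  have : IsManifold I 1 M := .of_le (n := 2) (by norm_num)
  let φ := extChartAt I x
  let V' := VectorField.mpullbackWithin 𝓘(ℝ, E) I φ.symm V (range I)
  let W' := VectorField.mpullbackWithin 𝓘(ℝ, E) I φ.symm W (range I)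
  have hφx : φ.symm (φ x) = x := extChartAt_to_inv x
  have hdφ : MDifferentiableAt I 𝓘(ℝ, E) φ x :=
    mdifferentiableAt_extChartAt (mem_chart_source H x)
  have hinv := isInvertible_mfderiv_extChartAt (I := I) (mem_extChartAt_source (I := I) x)
  have hset : φ.symm ⁻¹' univ ∩ range I = univ := by rw [I.range_eq_univ]; simp
  have hV' : DifferentiableAt ℝ V' (φ x) := by
    have := MDifferentiableWithinAt.differentiableWithinAt_mpullbackWithin_vectorField
      (s := univ) hV.mdifferentiableWithinAt
    rw [hset] at this
    exact differentiableWithinAt_univ.1 this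
  have hW' : DifferentiableAt ℝ W' (φ x) := by
    have := MDifferentiableWithinAt.differentiableWithinAt_mpullbackWithin_vectorField
      (s := univ) hW.mdifferentiableWithinAt
    rw [hset] at this
    exact differentiableWithinAt_univ.1 this
  have hfc : ContDiffAt ℝ 2 (f ∘ φ.symm) (φ x) := by
    have h1 := contMDiffWithinAt_extChartAt_symm_range_self (I := I) (n := 2) x
    rw [I.range_eq_univ, contMDiffWithinAt_univ] at h1
    have h2 : ContMDiffAt I 𝓘(ℝ, F) 2 f (φ.symm (φ x)) := by rwa [hφx]
    exact contMDiffAt_iff_contDiffAt.1 (h2.comp (φ x) h1)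
  have hev : ∀ᶠ q in 𝓝 x, q ∈ φ.source ∧ MDifferentiableAt I 𝓘(ℝ, F) f q := by
    filter_upwards [extChartAt_source_mem_nhds (I := I) x,
      (contMDiffAt_iff_contMDiffAt_nhds (n := 2) (by norm_num)).1 hf] with q hq hq'
    exact ⟨hq, hq'.mdifferentiableAt (by norm_num)⟩
  -- The chart expression is valid on a neighbourhood of `x`, not only at `x`, so it may be
  -- differentiated once more.
  have key : ∀ U : Π q : M, TangentSpace I q, (fun q => mvfderiv I f q (U q)) =ᶠ[𝓝 x]
      (fun y => fderiv ℝ (f ∘ φ.symm) y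
        (VectorField.mpullbackWithin 𝓘(ℝ, E) I φ.symm U (range I) y)) ∘ φ := by
    intro U
    filter_upwards [hev] with q ⟨hq, hq'⟩
    have hs : φ.symm (φ q) = q := φ.left_inv hq
    have h := mvfderiv_apply_extChartAt_symm (f := f) U (φ.map_source hq)
      (show MDifferentiableAt I 𝓘(ℝ, F) f (φ.symm (φ q)) by rwa [hs])
    exact ((by rw [hs]) : mvfderiv I f q (U q) =
      mvfderiv I f (φ.symm (φ q)) (U (φ.symm (φ q)))).trans h.symm
  have hval : ∀ U : Π q : M, TangentSpace I q, mfderiv I 𝓘(ℝ, E) φ x (U x) =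
      VectorField.mpullbackWithin 𝓘(ℝ, E) I φ.symm U (range I) (φ x) := by
    intro U
    have h := DFunLike.congr_fun (mfderivWithin_extChartAt_symm_comp_mfderiv_extChartAt' (I := I)
      (mem_extChartAt_source (I := I) x)) (U x)
    have hi := isInvertible_mfderivWithin_extChartAt_symm (I := I) (mem_extChartAt_target (I := I) x)
    rw [VectorField.mpullbackWithin_apply]
    have h2 : U (φ.symm (φ x)) = mfderivWithin 𝓘(ℝ, E) I φ.symm (range I) (φ x)
      (mfderiv I 𝓘(ℝ, E) φ x (U x)) := by
      refine Eq.trans ?_ h.symm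
      rw [hφx]; rfl
    refine Eq.trans ?_ (congrArg _ h2.symm)
    exact (hi.inverse_apply_self _).symm
  have hdiff : ∀ U : E → E, DifferentiableAt ℝ U (φ x) →
      DifferentiableAt ℝ (fun y => fderiv ℝ (f ∘ φ.symm) y (U y)) (φ x) := fun U hU =>
    (((hfc.fderiv_right (m := 1) (by norm_num)).differentiableAt (by norm_num))).clm_apply hU
  have hder : ∀ (U : Π q : M, TangentSpace I q) (w : TangentSpace I x),
      DifferentiableAt ℝ (VectorField.mpullbackWithin 𝓘(ℝ, E) I φ.symm U (range I)) (φ x) →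
      mvfderiv I (fun q => mvfderiv I f q (U q)) x w =
      fderiv ℝ (fun y => fderiv ℝ (f ∘ φ.symm) y
        (VectorField.mpullbackWithin 𝓘(ℝ, E) I φ.symm U (range I) y)) (φ x)
        (mfderiv I 𝓘(ℝ, E) φ x w) := by
    intro U w hU
    have h1 := (key U).mfderiv_eq (I := I) (I' := 𝓘(ℝ, F))
    have h2 := mfderiv_comp (I := I) (I' := 𝓘(ℝ, E)) (I'' := 𝓘(ℝ, F)) x
      (hdiff _ hU).mdifferentiableAt hdφ
    rw [mfderiv_eq_fderiv] at h2
    exact DFunLike.congr_fun (h1.trans h2) w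
  rw [hder V _ hV', hder W _ hW', hval, hval]
  refine Eq.trans ?_ (fderiv_lieBracket hfc hV' hW')
  have hcomp : f =ᶠ[𝓝 x] (f ∘ φ.symm) ∘ φ := by
    filter_upwards [hev] with q ⟨hq, _⟩
    exact congrArg f (φ.left_inv hq).symm
  have h1 := hcomp.mfderiv_eq (I := I) (I' := 𝓘(ℝ, F))
  have h2 := mfderiv_comp (I := I) (I' := 𝓘(ℝ, E)) (I'' := 𝓘(ℝ, F)) x
      (hfc.differentiableAt (by norm_num)).mdifferentiableAt hdφ
  rw [mfderiv_eq_fderiv] at h2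
  refine (DFunLike.congr_fun (h1.trans h2) _).trans ?_
  refine congrArg (fderiv ℝ (f ∘ φ.symm) (φ x)) ?_
  refine (hinv.self_apply_inverse _).trans ?_
  exact (congrArg (fun s => VectorField.lieBracketWithin ℝ V' W' s (φ x)) hset).trans
    (congrFun VectorField.lieBracketWithin_univ _)

/-- A vector field is differentiable at `x` if its coordinates in the chart at `x` are. -/
theorem mdifferentiableAt_vectorField_of_extChartAt [IsManifold I 1 M]
    {V : Π q : M, TangentSpace I q} {x : M}
    (h : MDifferentiableAt I 𝓘(ℝ, E) (fun q => mvfderiv I (extChartAt I x) q (V q)) x) :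
    MDifferentiableAt I I.tangent (fun q => (⟨q, V q⟩ : TangentBundle I M)) x := by
  refine (mdifferentiableAt_section (F := E) (E := (TangentSpace I : M → Type _)) I V).2 ?_
  refine h.congr_of_eventuallyEq ?_
  filter_upwards [(chartAt H x).open_source.mem_nhds (mem_chart_source H x)] with q hq
  -- The trivialization of the tangent bundle at `x` is the derivative of the chart at `x`, so both
  -- give the same coordinates.
  have h1 := TangentBundle.continuousLinearMapAt_trivializationAt (I := I) hq
  have h2 := Trivialization.coe_linearMapAt_of_mem (R := ℝ)
    (trivializationAt E (TangentSpace I : M → Type _) x) (b := q) (by simpa using hq)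
  exact (congrFun h2 (V q)).symm.trans (DFunLike.congr_fun h1 (V q))

/-- Every tangent vector extends to a smooth vector field on the whole manifold which, near the base
point, is constant in the chart. -/
theorem exists_contMDiff_eventuallyEq_extend [FiniteDimensional ℝ E] [T2Space M]
    [IsManifold I ∞ M] {p : M} (z : TangentSpace I p) :
    ∃ Z : Π q : M, TangentSpace I q,
      ContMDiff I I.tangent ∞ (fun q => (⟨q, Z q⟩ : TangentBundle I M)) ∧
      ∀ᶠ q in 𝓝 p, Z q = FiberBundle.extend E z q := by
  obtain ⟨s, hs, hsm⟩ := FiberBundle.exists_contMDiffOn_extend I E (k := ∞) z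
  -- A bump function supported where the local extension is smooth, equal to 1 near `p`.
  obtain ⟨f, -, hf⟩ := (SmoothBumpFunction.nhds_basis_tsupport (I := I) p).mem_iff.1
    (interior_mem_nhds.2 hs)
  refine ⟨(f : M → ℝ) • FiberBundle.extend E z, ?_, ?_⟩
  · exact ContMDiffOn.smul_section_of_tsupport f.contMDiff.contMDiffOn isOpen_interior hf
      (hsm.mono interior_subset)
  · filter_upwards [f.eventuallyEq_one] with q hq
    simp [hq]

end VectorFieldsOnManifolds

/-! ### Smooth fields, covariant derivatives and the first Bianchi identity. -/

section LeviCivitaCurvature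

variable {E : Type*} [NormedAddCommGroup E] [NormedSpace ℝ E]
  {H : Type*} [TopologicalSpace H] {I : ModelWithCorners ℝ E H}
  {M : Type*} [TopologicalSpace M] [ChartedSpace H M] [IsManifold I ∞ M]

/-- The vector field `X` is smooth on the whole manifold. -/
def IsSmoothField (X : Π p : M, TangentSpace I p) : Prop :=
  ContMDiff I I.tangent ∞ (fun p => (⟨p, X p⟩ : TangentBundle I M))

theorem IsSmoothField.mdifferentiableAt {X : Π p : M, TangentSpace I p} (hX : IsSmoothField X)
    (p : M) : MDifferentiableAt I I.tangent (fun q => (⟨q, X q⟩ : TangentBundle I M)) p :=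
  (hX p).mdifferentiableAt (by simp)

theorem IsSmoothField.mlieBracket [CompleteSpace E] {X Y : Π p : M, TangentSpace I p}
    (hX : IsSmoothField X) (hY : IsSmoothField Y) :
    IsSmoothField (VectorField.mlieBracket I X Y) := by
  have : IsManifold I (((⊤ : ℕ∞) : ℕ∞ω) + 1) M := inferInstanceAs (IsManifold I ∞ M)
  have : IsManifold I (minSmoothness ℝ 2) M := by
    rw [minSmoothness_of_isRCLikeNormedField]; infer_instance
  exact ContDiff.mlieBracket_vectorField (m := ⊤) (n := ⊤) hX hY (by simp)

theorem exists_isSmoothField_apply_eq [FiniteDimensional ℝ E] [T2Space M] {p : M}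
    (z : TangentSpace I p) : ∃ Z : Π q : M, TangentSpace I q, IsSmoothField Z ∧ Z p = z := by
  obtain ⟨Z, hZ, h⟩ := exists_contMDiff_eventuallyEq_extend (I := I) z
  exact ⟨Z, hZ, by simpa using h.self_of_nhds⟩

/-- The expression `∇_X ∇_Y Z - ∇_Y ∇_X Z - ∇_{[X, Y]} Z` at `p`, for vector fields. -/
noncomputable def curvatureOfFields (cov : CovariantDerivative I E (TangentSpace I : M → Type _))
    (X Y Z : Π p : M, TangentSpace I p) (p : M) : TangentSpace I p :=
  cov (fun q => cov Z q (Y q)) p (X p) - cov (fun q => cov Z q (X q)) p (Y p)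
    - cov Z p (VectorField.mlieBracket I X Y p)

theorem curvatureOfFields_swap (cov : CovariantDerivative I E (TangentSpace I : M → Type _))
    (X Y Z : Π p : M, TangentSpace I p) (p : M) :
    curvatureOfFields cov Y X Z p = -curvatureOfFields cov X Y Z p := by
  simp only [curvatureOfFields]
  rw [VectorField.mlieBracket_swap_apply, map_neg]
  abel

section Metric

variable (g : ContMDiffRiemannianMetric I ∞ E (TangentSpace I : M → Type _))

theorem ContMDiffRiemannianMetric.eq_of_forall_inner {p : M} {x y : TangentSpace I p}
    (h : ∀ z, g.inner p x z = g.inner p y z) : x = y := by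
  by_contra hxy
  have h1 := g.pos p (x - y) (sub_ne_zero.2 hxy)
  have h2 : g.inner p (x - y) (x - y) = 0 := by
    rw [map_sub (g.inner p) x y, sub_apply (g.inner p x), h, sub_self]
  rw [h2] at h1
  exact lt_irrefl _ h1

variable {g}

theorem IsSmoothField.inner {X Y : Π p : M, TangentSpace I p}
    (hX : IsSmoothField X) (hY : IsSmoothField Y) :
    ContMDiff I 𝓘(ℝ, ℝ) ∞ (fun q => g.inner q (X q) (Y q)) := by
  have h : ContMDiff I (I.prod 𝓘(ℝ, ℝ)) ∞
      (fun q => TotalSpace.mk' ℝ (E := Bundle.Trivial M ℝ) q (g.inner q (X q) (Y q))) :=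
    ContMDiff.clm_bundle_apply₂ (F₁ := E) (F₂ := E) (E₁ := (TangentSpace I : M → Type _))
      (E₂ := (TangentSpace I : M → Type _)) g.contMDiff hX hY
  intro q
  have := h q
  simp only [contMDiffAt_totalSpace] at this
  exact this.2

theorem IsSmoothField.mdifferentiableAt_inner {X Y : Π p : M, TangentSpace I p}
    (hX : IsSmoothField X) (hY : IsSmoothField Y) (p : M) :
    MDifferentiableAt I 𝓘(ℝ, ℝ) (fun q => g.inner q (X q) (Y q)) p :=
  (hX.inner hY p).mdifferentiableAt (by simp)

end Metric

variable {cov : CovariantDerivative I E (TangentSpace I : M → Type _)}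

theorem CovariantDerivative.apply_add_of_isSmoothField {X Y Z : Π p : M, TangentSpace I p}
    (hX : IsSmoothField X) (hY : IsSmoothField Y) (h : ∀ q, Z q = X q + Y q) (p : M)
    (v : TangentSpace I p) : cov Z p v = cov X p v + cov Y p v := by
  have hZ : Z = X + Y := funext h
  have h1 := cov.isCovariantDerivativeOn.add (s := univ) (hX.mdifferentiableAt p)
    (hY.mdifferentiableAt p)
  rw [hZ]
  exact DFunLike.congr_fun h1 v

variable {G : Π p : M, TangentSpace I p → TangentSpace I p → ℝ}

theorem IsLeviCivita.mvfderiv_inner {g : ContMDiffRiemannianMetric I ∞ E (TangentSpace I : M → Type _)}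
    (h : IsLeviCivita (fun p x y => g.inner p x y) cov)
    {Y Z : Π p : M, TangentSpace I p} (hY : IsSmoothField Y) (hZ : IsSmoothField Z) (p : M)
    (v : TangentSpace I p) :
    mvfderiv I (fun q => g.inner q (Y q) (Z q)) p v
      = g.inner p (cov Y p v) (Z p) + g.inner p (Y p) (cov Z p v) :=
  h.metric Y Z p v (hY.mdifferentiableAt p) (hZ.mdifferentiableAt p)

theorem IsLeviCivita.isSmoothField (h : IsLeviCivita G cov) {X Y : Π p : M, TangentSpace I p}
    (hX : IsSmoothField X) (hY : IsSmoothField Y) : IsSmoothField (fun q => cov Y q (X q)) := by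
  have h1 := h.smooth.contMDiff.contMDiff (σ := Y) (by
    rw [contMDiffOn_univ]; exact hY)
  rw [contMDiffOn_univ] at h1
  exact ContMDiff.clm_bundle_apply (F₁ := E) (F₂ := E) (E₁ := (TangentSpace I : M → Type _))
      (E₂ := (TangentSpace I : M → Type _)) h1 hX

/-- Since torsion vanishes, the second covariant derivatives in the cyclic sum group into iterated
brackets `[U, [V, W]]`, and the sum is zero by the Jacobi identity. -/
theorem IsLeviCivita.bianchi [FiniteDimensional ℝ E] (h : IsLeviCivita G cov)
    {X Y Z : Π p : M, TangentSpace I p} (hX : IsSmoothField X) (hY : IsSmoothField Y)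
    (hZ : IsSmoothField Z) (p : M) :
    curvatureOfFields cov X Y Z p + curvatureOfFields cov Y Z X p
      + curvatureOfFields cov Z X Y p = 0 := by
  have htor : ∀ {U V : Π p : M, TangentSpace I p}, IsSmoothField U → IsSmoothField V →
      ∀ q, cov V q (U q) = cov U q (V q) + VectorField.mlieBracket I U V q := fun hU hV q => by
    rw [← h.torsion_free _ _ q (hU.mdifferentiableAt q) (hV.mdifferentiableAt q)]; abel
  -- Torsion-freeness is used twice: for `∇_V W - ∇_W V = [V, W]`, and for `U` against `[V, W]`.
  have step : ∀ {U V W : Π p : M, TangentSpace I p}, IsSmoothField U → IsSmoothField V →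
      IsSmoothField W → cov (fun q => cov W q (V q)) p (U p) - cov (fun q => cov V q (W q)) p (U p)
        - cov U p (VectorField.mlieBracket I V W p)
        = VectorField.mlieBracket I U (VectorField.mlieBracket I V W) p := fun hU hV hW => by
    rw [CovariantDerivative.apply_add_of_isSmoothField (h.isSmoothField hW hV)
      (hV.mlieBracket hW) (htor hV hW) p, htor hU (hV.mlieBracket hW) p]
    abel
  have : IsManifold I (minSmoothness ℝ 3) M := by
    rw [minSmoothness_of_isRCLikeNormedField]; infer_instance
  have hle : minSmoothness ℝ 2 ≤ (∞ : ℕ∞ω) := by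
    rw [minSmoothness_of_isRCLikeNormedField]; exact ENat.LEInfty.out
  have hJ := VectorField.leibniz_identity_mlieBracket_apply (x := p) ((hX p).of_le hle)
    ((hY p).of_le hle) ((hZ p).of_le hle)
  have e1 := step hX hY hZ
  have e2 := step hY hZ hX
  have e3 := step hZ hX hY
  have hs : VectorField.mlieBracket I Z X = -VectorField.mlieBracket I X Z :=
    VectorField.mlieBracket_swap
  have f2 : VectorField.mlieBracket I Y (VectorField.mlieBracket I Z X) p =
      -VectorField.mlieBracket I Y (VectorField.mlieBracket I X Z) p := by
    have hc := VectorField.mlieBracket_const_smul_right (I := I) (V := Y) (x := p) (c := (-1 : ℝ))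
      ((hX.mlieBracket hZ).mdifferentiableAt p)
    rw [hs, ← neg_one_smul ℝ (VectorField.mlieBracket I X Z)]
    exact hc.trans (neg_one_smul ℝ _)
  have f3 := VectorField.mlieBracket_swap_apply (I := I) (V := Z)
    (W := VectorField.mlieBracket I X Y) (x := p)
  rw [f2] at e2
  rw [f3] at e3
  simp only [curvatureOfFields]
  rw [hJ] at e1
  have e := congrArg₂ (· + ·) (congrArg₂ (· + ·) e1 e2) e3
  refine Eq.trans ?_ (e.trans ?_)
  · abel
  · abel

end LeviCivitaCurvature

/-! ### Symmetries and tensoriality of the Riemann curvature. -/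

section RiemannCurvature

variable {E : Type*} [NormedAddCommGroup E] [NormedSpace ℝ E] [FiniteDimensional ℝ E]
  {H : Type*} [TopologicalSpace H] {I : ModelWithCorners ℝ E H} [I.Boundaryless]
  {M : Type*} [TopologicalSpace M] [ChartedSpace H M] [IsManifold I ∞ M]
  {g : ContMDiffRiemannianMetric I ∞ E (TangentSpace I : M → Type _)}
  {cov : CovariantDerivative I E (TangentSpace I : M → Type _)}

/-- Apply `XY - YX - [X, Y] = 0` to the function `g(Z, W)`: after two uses of metric compatibility
the mixed products of first derivatives are symmetric in `X`, `Y` and cancel. -/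
theorem IsLeviCivita.inner_curvatureOfFields_skew
    (h : IsLeviCivita (fun p x y => g.inner p x y) cov)
    {X Y Z W : Π p : M, TangentSpace I p} (hX : IsSmoothField X) (hY : IsSmoothField Y)
    (hZ : IsSmoothField Z) (hW : IsSmoothField W) (p : M) :
    g.inner p (curvatureOfFields cov X Y Z p) (W p) =
      -g.inner p (curvatureOfFields cov X Y W p) (Z p) := by
  have second : ∀ {U V : Π p : M, TangentSpace I p}, IsSmoothField U →
      IsSmoothField V → mvfderiv I (fun q => mvfderiv I (fun q => g.inner q (Z q) (W q)) q (V q)) p (U p) =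
        (g.inner p (cov (fun q => cov Z q (V q)) p (U p)) (W p)
          + g.inner p (cov Z p (V p)) (cov W p (U p)))
        + (g.inner p (cov Z p (U p)) (cov W p (V p))
          + g.inner p (Z p) (cov (fun q => cov W q (V q)) p (U p))) := fun {U V} hU hV => by
    have e := funext fun q => h.mvfderiv_inner hZ hW q (V q)
    rw [e, mvfderiv_fun_add ((h.isSmoothField hV hZ).mdifferentiableAt_inner hW p)
      (hZ.mdifferentiableAt_inner (h.isSmoothField hV hW) p), add_apply,
      h.mvfderiv_inner (h.isSmoothField hV hZ) hW, h.mvfderiv_inner hZ (h.isSmoothField hV hW)]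
  have hb := mvfderiv_mlieBracket (f := fun q => g.inner q (Z q) (W q)) (x := p)
    ((hZ.inner hW p).of_le (ENat.LEInfty.out)) (hX.mdifferentiableAt p) (hY.mdifferentiableAt p)
  rw [second hX hY, second hY hX, h.mvfderiv_inner hZ hW] at hb
  simp only [curvatureOfFields, map_sub, sub_apply]
  rw [g.symm p _ (Z p), g.symm p _ (Z p), g.symm p _ (Z p)]
  linarith

/-- The classical combination of four Bianchi identities, each pairing the cyclic sum over three of
the fields with the fourth, together with skew-symmetry in the first two and in the last two slots.
-/
theorem IsLeviCivita.inner_curvatureOfFields_pair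
    (h : IsLeviCivita (fun p x y => g.inner p x y) cov)
    {X Y Z W : Π p : M, TangentSpace I p} (hX : IsSmoothField X) (hY : IsSmoothField Y)
    (hZ : IsSmoothField Z) (hW : IsSmoothField W) (p : M) :
    g.inner p (curvatureOfFields cov X Y Z p) (W p) =
      g.inner p (curvatureOfFields cov Z W X p) (Y p) := by
  have B : ∀ {U V S T : Π p : M, TangentSpace I p}, IsSmoothField U → IsSmoothField V →
      IsSmoothField S → g.inner p (curvatureOfFields cov U V S p) (T p)
        + g.inner p (curvatureOfFields cov V S U p) (T p)
        + g.inner p (curvatureOfFields cov S U V p) (T p) = 0 := fun {U V S T} hU hV hS => by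
    have := congrArg (fun w => g.inner p w (T p)) (h.bianchi hU hV hS p)
    simpa only [map_add, add_apply, map_zero, zero_apply] using this
  have A : ∀ {U V S T : Π p : M, TangentSpace I p},
      g.inner p (curvatureOfFields cov U V S p) (T p) =
        -g.inner p (curvatureOfFields cov V U S p) (T p) := fun {U V S T} => by
    rw [curvatureOfFields_swap cov V U S p, map_neg, neg_apply]
  have b1 := B (T := W) hX hY hZ
  have b2 := B (T := X) hY hZ hW
  have b3 := B (T := Y) hZ hW hX
  have b4 := B (T := Z) hW hX hY
  have s := fun {U V S T : Π p : M, TangentSpace I p} (hU : IsSmoothField U)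
    (hV : IsSmoothField V) (hS : IsSmoothField S) (hT : IsSmoothField T) =>
    h.inner_curvatureOfFields_skew hU hV hS hT p
  have s1 := s hX hY hZ hW
  have s2 := s hY hZ hX hW
  have s3 := s hZ hX hY hW
  have s4 := s hZ hW hX hY
  have s5 := s hW hX hY hZ
  have s6 := s hW hY hZ hX
  have a1 := A (U := X) (V := W) (S := Z) (T := Y)
  have a2 := A (U := Y) (V := W) (S := X) (T := Z)
  have a3 := A (U := W) (V := Y) (S := Z) (T := X)
  have a4 := A (U := Z) (V := X) (S := W) (T := Y)
  linarith

variable [T2Space M]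

/-- Tensoriality follows from the symmetries alone: skew-symmetry moves `Z` to a slot where only its
value at `p` enters, and pair symmetry then brings `X` to the third slot and `Y` to the last. -/
theorem IsLeviCivita.curvatureOfFields_congr
    (h : IsLeviCivita (fun p x y => g.inner p x y) cov)
    {X Y Z X' Y' Z' : Π p : M, TangentSpace I p} (hX : IsSmoothField X) (hY : IsSmoothField Y)
    (hZ : IsSmoothField Z) (hX' : IsSmoothField X') (hY' : IsSmoothField Y')
    (hZ' : IsSmoothField Z') {p : M} (eX : X p = X' p) (eY : Y p = Y' p) (eZ : Z p = Z' p) :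
    curvatureOfFields cov X Y Z p = curvatureOfFields cov X' Y' Z' p := by
  have third : ∀ {U V S S' : Π p : M, TangentSpace I p}, IsSmoothField U → IsSmoothField V →
      IsSmoothField S → IsSmoothField S' → S p = S' p →
      curvatureOfFields cov U V S p = curvatureOfFields cov U V S' p :=
    fun hU hV hS hS' e => by
    refine ContMDiffRiemannianMetric.eq_of_forall_inner g fun w => ?_
    obtain ⟨W, hW, rfl⟩ := exists_isSmoothField_apply_eq (I := I) w
    rw [h.inner_curvatureOfFields_skew hU hV hS hW, h.inner_curvatureOfFields_skew hU hV hS' hW, e]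
  rw [third hX hY hZ hZ' eZ]
  refine ContMDiffRiemannianMetric.eq_of_forall_inner g fun w => ?_
  obtain ⟨W, hW, rfl⟩ := exists_isSmoothField_apply_eq (I := I) w
  rw [h.inner_curvatureOfFields_pair hX hY hZ' hW, h.inner_curvatureOfFields_pair hX' hY' hZ' hW,
    third hZ' hW hX hX' eX, eY]

/-- The curvature can be computed with arbitrary smooth vector fields. -/
theorem IsLeviCivita.curvature_apply
    (h : IsLeviCivita (fun p x y => g.inner p x y) cov)
    {X Y Z : Π p : M, TangentSpace I p} (hX : IsSmoothField X) (hY : IsSmoothField Y)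
    (hZ : IsSmoothField Z) (p : M) :
    curvature cov p (X p) (Y p) (Z p) = curvatureOfFields cov X Y Z p := by
  obtain ⟨X', hX', eX⟩ := exists_contMDiff_eventuallyEq_extend (I := I) (X p)
  obtain ⟨Y', hY', eY⟩ := exists_contMDiff_eventuallyEq_extend (I := I) (Y p)
  obtain ⟨Z', hZ', eZ⟩ := exists_contMDiff_eventuallyEq_extend (I := I) (Z p)
  have vX : X' p = X p := by simpa using eX.self_of_nhds
  have vY : Y' p = Y p := by simpa using eY.self_of_nhds
  have vZ : Z' p = Z p := by simpa using eZ.self_of_nhds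
  rw [h.curvatureOfFields_congr hX hY hZ hX' hY' hZ' vX.symm vY.symm vZ.symm]
  -- The fields used in `curvature` are controlled only near `p`. They agree there with global
  -- smooth fields, and locality of the connection makes the covariant derivatives agree near `p` as
  -- well, so nested derivatives can be compared.
  have hsec : ∀ {S S' : Π q : M, TangentSpace I q}, IsSmoothField S' →
      (∀ᶠ q in 𝓝 p, S' q = S q) → ∀ᶠ q in 𝓝 p, cov S' q = cov S q := fun {S S'} hS' e => by
    filter_upwards [e.eventually_nhds] with q hq
    refine cov.isCovariantDerivativeOn.congr_of_eventuallyEq (s := univ) (hS'.mdifferentiableAt q)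
      ?_ Filter.univ_mem hq
    refine (hS'.mdifferentiableAt q).congr_of_eventuallyEq ?_
    filter_upwards [hq] with r hr
    rw [hr]
  have hnest : ∀ {S S' U U' : Π q : M, TangentSpace I q}, IsSmoothField S' → IsSmoothField U' →
      (∀ᶠ q in 𝓝 p, S' q = S q) → (∀ᶠ q in 𝓝 p, U' q = U q) →
      cov (fun q => cov S' q (U' q)) p = cov (fun q => cov S q (U q)) p :=
    fun {S S' U U'} hS' hU' e e' => by
    refine (hsec (h.isSmoothField hU' hS') ?_).self_of_nhds
    filter_upwards [hsec hS' e, e'] with q h1 h2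
    rw [h1, h2]
  have hbr : VectorField.mlieBracket I X' Y' p = VectorField.mlieBracket I
      (FiberBundle.extend E (X p)) (FiberBundle.extend E (Y p)) p :=
    Filter.EventuallyEq.mlieBracket_vectorField_eq eX eY
  simp only [curvature, curvatureOfFields]
  rw [hnest hZ' hY' eZ eY, hnest hZ' hX' eZ eX, (hsec hZ' eZ).self_of_nhds, hbr, vX, vY]

theorem IsLeviCivita.inner_curvature_skew (h : IsLeviCivita (fun p x y => g.inner p x y) cov)
    (p : M) (x y z w : TangentSpace I p) :
    g.inner p (curvature cov p x y z) w = -g.inner p (curvature cov p x y w) z := by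
  obtain ⟨X, hX, rfl⟩ := exists_isSmoothField_apply_eq (I := I) x
  obtain ⟨Y, hY, rfl⟩ := exists_isSmoothField_apply_eq (I := I) y
  obtain ⟨Z, hZ, rfl⟩ := exists_isSmoothField_apply_eq (I := I) z
  obtain ⟨W, hW, rfl⟩ := exists_isSmoothField_apply_eq (I := I) w
  rw [h.curvature_apply hX hY hZ, h.curvature_apply hX hY hW,
    h.inner_curvatureOfFields_skew hX hY hZ hW]

theorem IsLeviCivita.inner_curvature_pair (h : IsLeviCivita (fun p x y => g.inner p x y) cov)
    (p : M) (x y z w : TangentSpace I p) :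
    g.inner p (curvature cov p x y z) w = g.inner p (curvature cov p z w x) y := by
  obtain ⟨X, hX, rfl⟩ := exists_isSmoothField_apply_eq (I := I) x
  obtain ⟨Y, hY, rfl⟩ := exists_isSmoothField_apply_eq (I := I) y
  obtain ⟨Z, hZ, rfl⟩ := exists_isSmoothField_apply_eq (I := I) z
  obtain ⟨W, hW, rfl⟩ := exists_isSmoothField_apply_eq (I := I) w
  rw [h.curvature_apply hX hY hZ, h.curvature_apply hZ hW hX,
    h.inner_curvatureOfFields_pair hX hY hZ hW]

end RiemannCurvature

/-! ### The horizontal-vertical splitting of `T(TM)` and derivatives along lifts. -/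

section LiftCalculus

variable {E : Type*} [NormedAddCommGroup E] [NormedSpace ℝ E]
  {H : Type*} [TopologicalSpace H] {I : ModelWithCorners ℝ E H}
  {M : Type*} [TopologicalSpace M] [ChartedSpace H M] [IsManifold I ∞ M]
  {F : Type*} [NormedAddCommGroup F] [NormedSpace ℝ F]

section Linear

variable (cov : CovariantDerivative I E (TangentSpace I : M → Type _)) (u : TangentBundle I M)
  (x y : TangentSpace I u.proj) (c : ℝ)

theorem verticalLift_add : verticalLift u (x + y) = verticalLift u x + verticalLift u y :=
  map_add (mfderiv 𝓘(ℝ, E) I.tangent (fun v : E => (⟨u.proj, v⟩ : TangentBundle I M)) u.snd) x y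

theorem verticalLift_smul : verticalLift u (c • x) = c • verticalLift u x :=
  map_smul (mfderiv 𝓘(ℝ, E) I.tangent (fun v : E => (⟨u.proj, v⟩ : TangentBundle I M)) u.snd) c x

theorem horizontalLift_smul :
    horizontalLift cov u (c • x) = c • horizontalLift cov u x := by
  simp only [horizontalLift, map_smul, verticalLift_smul]
  exact (smul_sub (A := E × E) c _ _).symm

theorem verticalLift_zero : verticalLift u (0 : TangentSpace I u.proj) = 0 :=
  (congrArg _ (zero_smul ℝ (0 : TangentSpace I u.proj)).symm).trans
    ((verticalLift_smul u 0 0).trans (zero_smul ℝ _))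

theorem horizontalLift_zero : horizontalLift cov u (0 : TangentSpace I u.proj) = 0 := by
  have := horizontalLift_smul cov u 0 0
  rwa [smul_zero, zero_smul] at this

/-- A tangent vector of `TM` is determined by its projection to `M` and its image under the
connection map. -/
theorem tangentBundle_tangent_ext [FiniteDimensional ℝ E] {ξ η : TangentSpace I.tangent u}
    (h1 : mfderiv I.tangent I (TotalSpace.proj : TangentBundle I M → M) u ξ =
      mfderiv I.tangent I (TotalSpace.proj : TangentBundle I M → M) u η)
    (h2 : connectionMap cov u ξ = connectionMap cov u η) : ξ = η := by
  let dπ : E × E →ₗ[ℝ] E := (mfderiv I.tangent I (TotalSpace.proj : TangentBundle I M → M) u :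
    TangentSpace I.tangent u →L[ℝ] TangentSpace I u.proj).toLinearMap
  let K : E × E →ₗ[ℝ] E := (connectionMap cov u).toLinearMap
  -- The lifts give surjectivity of `(dπ, K) : E × E → E × E`; injectivity then follows by finite
  -- dimension.
  have hsurj : Function.Surjective (dπ.prod K) := by
    intro w
    let x : TangentSpace I u.proj := w.1
    let y : TangentSpace I u.proj := w.2
    refine ⟨horizontalLift cov u x + verticalLift u y, Prod.ext ?_ ?_⟩
    · refine (map_add (mfderiv I.tangent I (TotalSpace.proj : TangentBundle I M → M) u)
        (horizontalLift cov u x) (verticalLift u y)).trans ?_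
      rw [mfderiv_proj_horizontalLift, mfderiv_proj_verticalLift, add_zero]
    · refine (map_add (connectionMap cov u) (horizontalLift cov u x) (verticalLift u y)).trans ?_
      rw [connectionMap_horizontalLift, connectionMap_verticalLift, zero_add]
  exact (LinearMap.injective_iff_surjective.2 hsurj) (Prod.ext h1 h2)

theorem eq_horizontalLift_add_verticalLift [FiniteDimensional ℝ E]
    (ξ : TangentSpace I.tangent u) :
    ξ = horizontalLift cov u (mfderiv I.tangent I (TotalSpace.proj : TangentBundle I M → M) u ξ)
      + verticalLift u (connectionMap cov u ξ) := by
  refine tangentBundle_tangent_ext cov u ?_ ?_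
  · refine Eq.symm ((map_add (mfderiv I.tangent I (TotalSpace.proj : TangentBundle I M → M) u)
        _ _).trans ?_)
    rw [mfderiv_proj_horizontalLift, mfderiv_proj_verticalLift, add_zero]
  · rw [map_add, connectionMap_horizontalLift, connectionMap_verticalLift, zero_add]

end Linear

theorem fderiv_clm_apply_self (B : E →L[ℝ] E →L[ℝ] F) (x y : E) :
    fderiv ℝ (fun z => B z z) x y = B x y + B y x := by
  have h := (B.hasFDerivAt.clm_apply (hasFDerivAt_id (𝕜 := ℝ) x)).fderiv
  exact DFunLike.congr_fun h y

theorem mvfderiv_verticalLift {f : TangentBundle I M → F} {u : TangentBundle I M}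
    (hf : MDifferentiableAt I.tangent 𝓘(ℝ, F) f u) (y : TangentSpace I u.proj) :
    mvfderiv I.tangent f u (verticalLift u y) =
      fderiv ℝ (E := E) (fun z : E => f (⟨u.proj, z⟩ : TangentBundle I M)) u.snd y := by
  have h := mfderiv_comp (I := 𝓘(ℝ, E)) (I' := I.tangent) (I'' := 𝓘(ℝ, F)) (x := (u.snd : E))
    (g := f) (f := (fun v : E => (⟨u.proj, v⟩ : TangentBundle I M))) hf
    (mdifferentiableAt_fibre (E := E) u.proj u.snd)
  have h2 := mfderiv_eq_fderiv (𝕜 := ℝ) (E := E) (f := fun z : E => f (⟨u.proj, z⟩ : TangentBundle I M))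
    (x := u.snd)
  exact (DFunLike.congr_fun (h2.symm.trans h) y).symm

theorem mvfderiv_mfderiv_section {f : TangentBundle I M → F} {u : TangentBundle I M}
    (hf : MDifferentiableAt I.tangent 𝓘(ℝ, F) f u) {σ : Π q : M, TangentSpace I q}
    (hσ : MDifferentiableAt I I.tangent (fun q => (⟨q, σ q⟩ : TangentBundle I M)) u.proj)
    (e : σ u.proj = u.snd) (x : TangentSpace I u.proj) :
    mvfderiv I.tangent f u
        (mfderiv I I.tangent (fun q => (⟨q, σ q⟩ : TangentBundle I M)) u.proj x) =
      mvfderiv I (fun q => f (⟨q, σ q⟩ : TangentBundle I M)) u.proj x := by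
  have e' : (⟨u.proj, σ u.proj⟩ : TangentBundle I M) = u := by rw [e]
  have h := mfderiv_comp_of_eq (I := I) (I' := I.tangent) (I'' := 𝓘(ℝ, F)) (x := u.proj)
    (g := f) (f := (fun q : M => (⟨q, σ q⟩ : TangentBundle I M))) hf hσ e'
  -- The base points `σ(p)` and `u` are only propositionally equal, so the derivatives are compared
  -- as maps on the model space `E × E`.
  have h2 : (mvfderiv I.tangent f u : E × E →L[ℝ] F) =
      mfderiv I.tangent 𝓘(ℝ, F) f (⟨u.proj, σ u.proj⟩ : TangentBundle I M) := by rw [e']; rfl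
  exact (DFunLike.congr_fun h2 _).trans (DFunLike.congr_fun h x).symm

theorem mfderiv_proj_mfderiv_section {u : TangentBundle I M} {σ : Π q : M, TangentSpace I q}
    (hσ : MDifferentiableAt I I.tangent (fun q => (⟨q, σ q⟩ : TangentBundle I M)) u.proj)
    (e : σ u.proj = u.snd) (x : TangentSpace I u.proj) :
    mfderiv I.tangent I (TotalSpace.proj : TangentBundle I M → M) u
        (mfderiv I I.tangent (fun q => (⟨q, σ q⟩ : TangentBundle I M)) u.proj x) = x := by
  have e' : (⟨u.proj, σ u.proj⟩ : TangentBundle I M) = u := by rw [e]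
  have h := mfderiv_comp_of_eq (I := I) (I' := I.tangent) (I'' := I) (x := u.proj)
    (g := (TotalSpace.proj : TangentBundle I M → M))
    (f := (fun q : M => (⟨q, σ q⟩ : TangentBundle I M))) (mdifferentiableAt_proj _) hσ e'
  have h2 : (mfderiv I.tangent I (TotalSpace.proj : TangentBundle I M → M) u : E × E →L[ℝ] E) =
      mfderiv I.tangent I (TotalSpace.proj : TangentBundle I M → M)
        (⟨u.proj, σ u.proj⟩ : TangentBundle I M) := by rw [e']
  have h1 := (mfderiv_id (I := I) (x := u.proj)).symm.trans h
  exact (DFunLike.congr_fun h2 _).trans (DFunLike.congr_fun h1 x).symm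

theorem mvfderiv_horizontalLift (cov : CovariantDerivative I E (TangentSpace I : M → Type _))
    {f : TangentBundle I M → F} {u : TangentBundle I M}
    (hf : MDifferentiableAt I.tangent 𝓘(ℝ, F) f u) (x : TangentSpace I u.proj) :
    mvfderiv I.tangent f u (horizontalLift cov u x) =
      mvfderiv I (fun q => f (⟨q, FiberBundle.extend E u.snd q⟩ : TangentBundle I M)) u.proj x
      - fderiv ℝ (E := E) (fun z : E => f (⟨u.proj, z⟩ : TangentBundle I M)) u.snd
        (cov (FiberBundle.extend E u.snd) u.proj x) := by
  rw [← mvfderiv_verticalLift hf, ← mvfderiv_mfderiv_section hf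
    (FiberBundle.mdifferentiableAt_extend I E u.snd) (FiberBundle.extend_apply_self E u.snd)]
  exact map_sub (mvfderiv I.tangent f u) _ _

theorem mvfderiv_comp_proj {f : M → F} {u : TangentBundle I M}
    (hf : MDifferentiableAt I 𝓘(ℝ, F) f u.proj) (ξ : TangentSpace I.tangent u) :
    mvfderiv I.tangent (fun v : TangentBundle I M => f v.proj) u ξ =
      mvfderiv I f u.proj (mfderiv I.tangent I (TotalSpace.proj : TangentBundle I M → M) u ξ) := by
  have h := mfderiv_comp (I := I.tangent) (I' := I) (I'' := 𝓘(ℝ, F)) (x := u) (g := f)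
    (f := (TotalSpace.proj : TangentBundle I M → M)) hf (mdifferentiableAt_proj _)
  exact DFunLike.congr_fun h ξ

section Metric

variable {g : ContMDiffRiemannianMetric I ∞ E (TangentSpace I : M → Type _)}
  {cov : CovariantDerivative I E (TangentSpace I : M → Type _)}

/-- The identity of `TM` serves as the tautological section `v ↦ v` along `π`; it is paired with `Z
∘ π` under the smooth bundle metric. -/
theorem contMDiff_inner_snd {Z : Π p : M, TangentSpace I p} (hZ : IsSmoothField Z) :
    ContMDiff I.tangent 𝓘(ℝ, ℝ) ∞
      (fun v : TangentBundle I M => g.inner v.proj (Z v.proj) v.snd) := by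
  have hp : ContMDiff I.tangent I ∞ (TotalSpace.proj : TangentBundle I M → M) :=
    contMDiff_proj _
  have h : ContMDiff I.tangent (I.prod 𝓘(ℝ, ℝ)) ∞
      (fun v : TangentBundle I M => TotalSpace.mk' ℝ (E := Bundle.Trivial M ℝ) v.proj
        (g.inner v.proj (Z v.proj) v.snd)) :=
    ContMDiff.clm_bundle_apply₂ (F₁ := E) (F₂ := E) (E₁ := (TangentSpace I : M → Type _))
      (E₂ := (TangentSpace I : M → Type _)) (g.contMDiff.comp hp) (hZ.comp hp) contMDiff_id
  intro q
  have := h q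
  simp only [contMDiffAt_totalSpace] at this
  exact this.2

theorem contMDiff_inner_snd_snd :
    ContMDiff I.tangent 𝓘(ℝ, ℝ) ∞
      (fun v : TangentBundle I M => g.inner v.proj v.snd v.snd) := by
  have hp : ContMDiff I.tangent I ∞ (TotalSpace.proj : TangentBundle I M → M) :=
    contMDiff_proj _
  have h : ContMDiff I.tangent (I.prod 𝓘(ℝ, ℝ)) ∞
      (fun v : TangentBundle I M => TotalSpace.mk' ℝ (E := Bundle.Trivial M ℝ) v.proj
        (g.inner v.proj v.snd v.snd)) :=
    ContMDiff.clm_bundle_apply₂ (F₁ := E) (F₂ := E) (E₁ := (TangentSpace I : M → Type _))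
      (E₂ := (TangentSpace I : M → Type _)) (g.contMDiff.comp hp) contMDiff_id contMDiff_id
  intro q
  have := h q
  simp only [contMDiffAt_totalSpace] at this
  exact this.2

theorem mdifferentiableAt_inner_snd {Z : Π p : M, TangentSpace I p} (hZ : IsSmoothField Z)
    (u : TangentBundle I M) : MDifferentiableAt I.tangent 𝓘(ℝ, ℝ)
      (fun v : TangentBundle I M => g.inner v.proj (Z v.proj) v.snd) u :=
  (contMDiff_inner_snd hZ u).mdifferentiableAt (by simp)

theorem mdifferentiableAt_inner_snd_snd (u : TangentBundle I M) :
    MDifferentiableAt I.tangent 𝓘(ℝ, ℝ)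
      (fun v : TangentBundle I M => g.inner v.proj v.snd v.snd) u :=
  (contMDiff_inner_snd_snd u).mdifferentiableAt (by simp)

/-- The derivative of the fibrewise linear function `v ↦ g(Z, v)` on `TM`. -/
theorem IsLeviCivita.mvfderiv_inner_snd [FiniteDimensional ℝ E]
    (h : IsLeviCivita (fun p x y => g.inner p x y) cov)
    {Z : Π p : M, TangentSpace I p} (hZ : IsSmoothField Z) (u : TangentBundle I M)
    (ξ : TangentSpace I.tangent u) :
    mvfderiv I.tangent (fun v : TangentBundle I M => g.inner v.proj (Z v.proj) v.snd) u ξ =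
      g.inner u.proj
        (cov Z u.proj (mfderiv I.tangent I (TotalSpace.proj : TangentBundle I M → M) u ξ)) u.snd
      + g.inner u.proj (Z u.proj) (connectionMap cov u ξ) := by
  have hd := mdifferentiableAt_inner_snd (g := g) hZ u
  have hf : ∀ y : E, fderiv ℝ (E := E) (fun z : E => g.inner u.proj (Z u.proj) z) u.snd y =
      g.inner u.proj (Z u.proj) y := fun y => by
    have := (g.inner u.proj (Z u.proj) : E →L[ℝ] ℝ).fderiv (x := u.snd)
    exact DFunLike.congr_fun this y
  -- Compatibility along the section through `u` yields `g(∇Z, u) + g(Z, ∇σ)`. The second term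
  -- cancels against the vertical correction in the horizontal lift.
  have hm := h.metric Z (FiberBundle.extend E u.snd) u.proj
    (mfderiv I.tangent I (TotalSpace.proj : TangentBundle I M → M) u ξ) (hZ.mdifferentiableAt _)
    (FiberBundle.mdifferentiableAt_extend I E u.snd)
  conv_lhs => rw [eq_horizontalLift_add_verticalLift cov u ξ]
  rw [map_add, mvfderiv_verticalLift hd, mvfderiv_horizontalLift cov hd]
  refine (congrArg₂ (· + ·) (congrArg₂ (· - ·) hm (hf _)) (hf _)).trans ?_
  rw [FiberBundle.extend_apply_self]
  abel

/-- The derivative of the function `v ↦ g(v, v)` on `TM`. -/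
theorem IsLeviCivita.mvfderiv_inner_snd_snd [FiniteDimensional ℝ E]
    (h : IsLeviCivita (fun p x y => g.inner p x y) cov) (u : TangentBundle I M)
    (ξ : TangentSpace I.tangent u) :
    mvfderiv I.tangent (fun v : TangentBundle I M => g.inner v.proj v.snd v.snd) u ξ =
      2 * g.inner u.proj (connectionMap cov u ξ) u.snd := by
  have hd := mdifferentiableAt_inner_snd_snd (g := g) u
  have hf : ∀ y : E, fderiv ℝ (E := E) (fun z : E => g.inner u.proj z z) u.snd y =
      g.inner u.proj u.snd y + g.inner u.proj y u.snd := fun y =>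
    fderiv_clm_apply_self (E := E) (g.inner u.proj : E →L[ℝ] E →L[ℝ] ℝ) u.snd y
  have hm := h.metric (FiberBundle.extend E u.snd) (FiberBundle.extend E u.snd) u.proj
    (mfderiv I.tangent I (TotalSpace.proj : TangentBundle I M → M) u ξ)
    (FiberBundle.mdifferentiableAt_extend I E u.snd)
    (FiberBundle.mdifferentiableAt_extend I E u.snd)
  conv_lhs => rw [eq_horizontalLift_add_verticalLift cov u ξ]
  rw [map_add, mvfderiv_verticalLift hd, mvfderiv_horizontalLift cov hd]
  refine (congrArg₂ (· + ·) (congrArg₂ (· - ·) hm (hf _)) (hf _)).trans ?_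
  rw [FiberBundle.extend_apply_self, g.symm u.proj u.snd, g.symm u.proj u.snd]
  ring

end Metric

end LiftCalculus

/-! ### Differentiability of lifted vector fields on `TM`. -/

section LiftsAreDifferentiable

variable {E : Type*} [NormedAddCommGroup E] [NormedSpace ℝ E]
  {H : Type*} [TopologicalSpace H] {I : ModelWithCorners ℝ E H}
  {M : Type*} [TopologicalSpace M] [ChartedSpace H M] [IsManifold I ∞ M]
  {g : ContMDiffRiemannianMetric I ∞ E (TangentSpace I : M → Type _)}
  {cov : CovariantDerivative I E (TangentSpace I : M → Type _)}

theorem trivializationAt_apply_snd {p q : M}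
    (hq : q ∈ (trivializationAt E (TangentSpace I : M → Type _) p).baseSet)
    (w : TangentSpace I q) :
    (trivializationAt E (TangentSpace I : M → Type _) p (⟨q, w⟩ : TangentBundle I M)).2 =
      (trivializationAt E (TangentSpace I : M → Type _) p).continuousLinearMapAt ℝ q w :=
  (congrFun (Trivialization.coe_linearMapAt_of_mem (R := ℝ)
    (trivializationAt E (TangentSpace I : M → Type _) p) hq) w).symm

theorem mdifferentiableAt_trivializationAt_snd {p : M} {v : TangentBundle I M}
    (hv : v.proj ∈ (trivializationAt E (TangentSpace I : M → Type _) p).baseSet) :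
    MDifferentiableAt I.tangent 𝓘(ℝ, E) (fun w : TangentBundle I M =>
      (trivializationAt E (TangentSpace I : M → Type _) p w).2) v :=
  ((Trivialization.mdifferentiableAt_totalSpace_iff (IB := I)
    (trivializationAt E (TangentSpace I : M → Type _) p) (id : TangentBundle I M → _)
    (by rw [Trivialization.mem_source]; exact hv)).1 mdifferentiableAt_id).2

theorem IsSmoothField.mdifferentiableAt_continuousLinearMapAt {W : Π q : M, TangentSpace I q}
    (hW : IsSmoothField W) (p : M) :
    MDifferentiableAt I 𝓘(ℝ, E) (fun q =>
      (trivializationAt E (TangentSpace I : M → Type _) p).continuousLinearMapAt ℝ q (W q)) p := by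
  have h := (mdifferentiableAt_section (F := E) (E := (TangentSpace I : M → Type _)) I W).1
    (hW.mdifferentiableAt p)
  refine h.congr_of_eventuallyEq ?_
  filter_upwards [(trivializationAt E (TangentSpace I : M → Type _) p).open_baseSet.mem_nhds
    (FiberBundle.mem_baseSet_trivializationAt' p)] with q hq
  exact (trivializationAt_apply_snd hq _).symm

/-- Constant combinations of global fields represent, near a point, the fields that are constant in
a trivialization, with coefficients depending on the chosen `v`. -/
theorem IsSmoothField.sum_smul {ι : Type*} (s : Finset ι) (c : ι → ℝ)
    {S : ι → Π q : M, TangentSpace I q} (hS : ∀ i, IsSmoothField (S i)) :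
    IsSmoothField (fun q => ∑ i ∈ s, c i • S i q) := by
  classical
  induction s using Finset.induction with
  | empty =>
    simp only [Finset.sum_empty]
    exact contMDiff_zeroSection ℝ (TangentSpace I : M → Type _)
  | insert i s hi ih =>
    simp only [Finset.sum_insert hi]
    exact ContMDiff.add_section (ContMDiff.const_smul_section (hS i)) ih

theorem CovariantDerivative.apply_sum_smul {ι : Type*} (s : Finset ι) (c : ι → ℝ)
    {S : ι → Π q : M, TangentSpace I q} (hS : ∀ i, IsSmoothField (S i)) (p : M)
    (x : TangentSpace I p) :
    cov (fun q => ∑ i ∈ s, c i • S i q) p x = ∑ i ∈ s, c i • cov (S i) p x := by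
  classical
  induction s using Finset.induction with
  | empty =>
    have h := congrFun cov.zero p
    simp only [Finset.sum_empty]
    exact DFunLike.congr_fun h x
  | insert i s hi ih =>
    have h1 := cov.isCovariantDerivativeOn.smul_const (s := univ) (c i)
      ((hS i).mdifferentiableAt p)
    have hs : IsSmoothField (c i • S i) := ContMDiff.const_smul_section (hS i)
    rw [CovariantDerivative.apply_add_of_isSmoothField hs (IsSmoothField.sum_smul s c hS)
      (fun q => Finset.sum_insert hi), Finset.sum_insert hi, ih]
    exact congrArg (· + _) (DFunLike.congr_fun h1 x)

variable [FiniteDimensional ℝ E]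

/-- In the trivialization `e` of `TM`, the derivative of the fibre coordinate of a tangent vector
`ξ` of `TM` at `v` is `e (K ξ - ∇_{dπ ξ} σ)`, where `σ` is the field through `v` that is constant
in `e`. -/
theorem mvfderiv_trivializationAt_snd [T2Space M]
    (h : IsLeviCivita (fun p x y => g.inner p x y) cov) {p : M} {v : TangentBundle I M}
    (hv : v.proj ∈ (trivializationAt E (TangentSpace I : M → Type _) p).baseSet)
    {σ : Π q : M, TangentSpace I q} (hσ : IsSmoothField σ)
    (hσv : ∀ᶠ q in 𝓝 v.proj, σ q = (trivializationAt E (TangentSpace I : M → Type _) p).symm q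
      (trivializationAt E (TangentSpace I : M → Type _) p v).2)
    (ξ : TangentSpace I.tangent v) :
    mvfderiv I.tangent (fun w : TangentBundle I M =>
      (trivializationAt E (TangentSpace I : M → Type _) p w).2) v ξ =
    (trivializationAt E (TangentSpace I : M → Type _) p).continuousLinearMapAt ℝ v.proj
      (connectionMap cov v ξ - cov σ v.proj
        (mfderiv I.tangent I (TotalSpace.proj : TangentBundle I M → M) v ξ)) := by
  let e := trivializationAt E (TangentSpace I : M → Type _) p
  have hd := mdifferentiableAt_trivializationAt_snd (I := I) hv
  have e0 : σ v.proj = v.snd := by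
    rw [hσv.self_of_nhds]
    exact Trivialization.symm_proj_apply _ _ hv
  have hvert : ∀ y : TangentSpace I v.proj, mvfderiv I.tangent (fun w : TangentBundle I M =>
      (e w).2) v (verticalLift v y) = e.continuousLinearMapAt ℝ v.proj y := fun y => by
    rw [mvfderiv_verticalLift hd]
    have h1 : (fun z : E => (e (⟨v.proj, z⟩ : TangentBundle I M)).2) =
      (e.continuousLinearMapAt ℝ v.proj : E →L[ℝ] E) :=
      funext fun z => trivializationAt_apply_snd (I := I) hv z
    have h2 := (e.continuousLinearMapAt ℝ v.proj : E →L[ℝ] E).fderiv (x := v.snd)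
    rw [← h1] at h2
    exact DFunLike.congr_fun h2 y
  have hsec : ∀ x : TangentSpace I v.proj, mvfderiv I.tangent (fun w : TangentBundle I M =>
      (e w).2) v (mfderiv I I.tangent (fun q => (⟨q, σ q⟩ : TangentBundle I M)) v.proj x) = 0 :=
    fun x => by
    rw [mvfderiv_mfderiv_section hd (hσ.mdifferentiableAt _) e0]
    have h2 : (fun q => (e (⟨q, σ q⟩ : TangentBundle I M)).2) =ᶠ[𝓝 v.proj] fun _ => (e v).2 := by
      filter_upwards [hσv, e.open_baseSet.mem_nhds hv] with q hq hq'
      rw [hq, e.apply_mk_symm hq']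
    have h3 := (h2.mfderiv_eq (I := I) (I' := 𝓘(ℝ, E))).trans mfderiv_const
    exact DFunLike.congr_fun h3 x
  -- `K (dσ x) = ∇_x σ`. The definition of `K` at `v` uses the trivialization at `v.proj`, whereas
  -- `σ` is constant in the one at `p`; testing against `v ↦ g(Z, v)` avoids a change of
  -- trivialization.
  have hK : ∀ x : TangentSpace I v.proj, connectionMap cov v
      (mfderiv I I.tangent (fun q => (⟨q, σ q⟩ : TangentBundle I M)) v.proj x) = cov σ v.proj x :=
    fun x => by
    refine ContMDiffRiemannianMetric.eq_of_forall_inner g fun z => ?_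
    obtain ⟨Z, hZ, rfl⟩ := exists_isSmoothField_apply_eq (I := I) z
    have h1 := h.mvfderiv_inner_snd hZ v
      (mfderiv I I.tangent (fun q => (⟨q, σ q⟩ : TangentBundle I M)) v.proj x)
    rw [mvfderiv_mfderiv_section (mdifferentiableAt_inner_snd hZ v) (hσ.mdifferentiableAt _) e0,
      mfderiv_proj_mfderiv_section (hσ.mdifferentiableAt _) e0] at h1
    have h2 := h.mvfderiv_inner hZ hσ v.proj x
    rw [e0] at h2
    rw [g.symm v.proj _ (Z v.proj), g.symm v.proj _ (Z v.proj)]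
    have h3 := h1.symm.trans h2
    linarith
  let D : TangentSpace I.tangent v :=
    mfderiv I I.tangent (fun q => (⟨q, σ q⟩ : TangentBundle I M)) v.proj
      (mfderiv I.tangent I (TotalSpace.proj : TangentBundle I M → M) v ξ)
  have hD := mfderiv_proj_mfderiv_section (hσ.mdifferentiableAt _) e0
    (mfderiv I.tangent I (TotalSpace.proj : TangentBundle I M → M) v ξ)
  have hdec : ξ = D + verticalLift v (connectionMap cov v ξ - cov σ v.proj
        (mfderiv I.tangent I (TotalSpace.proj : TangentBundle I M → M) v ξ)) := by
    refine tangentBundle_tangent_ext cov v ?_ ?_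
    · refine Eq.symm ((map_add (mfderiv I.tangent I (TotalSpace.proj : TangentBundle I M → M) v)
        _ _).trans ?_)
      rw [mfderiv_proj_verticalLift, add_zero]
      exact hD
    · refine Eq.symm ((map_add (connectionMap cov v) _ _).trans ?_)
      rw [connectionMap_verticalLift]
      exact (congrArg (· + _) (hK _)).trans (add_sub_cancel _ _)
  refine (congrArg _ hdec).trans ((map_add (mvfderiv I.tangent (fun w : TangentBundle I M =>
      (e w).2) v) _ _).trans ?_)
  rw [hvert]
  exact (congrArg (· + _) (hsec _)).trans (zero_add _)

omit [FiniteDimensional ℝ E] in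
-- Near `v` the chart of `TM` at `u` is the base chart paired with the fibre coordinate, and the
-- derivative of the base chart is the trivialization itself.
theorem mvfderiv_extChartAt_tangentBundle {u v : TangentBundle I M}
    (hv : v.proj ∈ (chartAt H u.proj).source) (ξ : TangentSpace I.tangent v) :
    mvfderiv I.tangent (extChartAt I.tangent u) v ξ =
      ((trivializationAt E (TangentSpace I : M → Type _) u.proj).continuousLinearMapAt ℝ v.proj
        (mfderiv I.tangent I (TotalSpace.proj : TangentBundle I M → M) v ξ),
      mvfderiv I.tangent (fun w : TangentBundle I M =>
        (trivializationAt E (TangentSpace I : M → Type _) u.proj w).2) v ξ) := by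
  have hv' : v.proj ∈ (trivializationAt E (TangentSpace I : M → Type _) u.proj).baseSet := by
    simpa using hv
  have hev : (extChartAt I.tangent u : TangentBundle I M → E × E) =ᶠ[𝓝 v] fun w =>
      (extChartAt I u.proj w.proj,
        (trivializationAt E (TangentSpace I : M → Type _) u.proj w).2) := by
    have hs : {w : TangentBundle I M | w.proj ∈ (chartAt H u.proj).source} ∈ 𝓝 v :=
      (FiberBundle.continuous_proj E (TangentSpace I : M → Type _)).continuousAt.preimage_mem_nhds
        ((chartAt H u.proj).open_source.mem_nhds hv)
    filter_upwards [hs] with w hw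
    rw [FiberBundle.extChartAt]
    have : (trivializationAt E (TangentSpace I : M → Type _) u.proj w).1 = w.proj := by
      simp
    simp [this]
  have h1 := hev.mfderiv_eq (I := I.tangent) (I' := 𝓘(ℝ, E × E))
  have hd1 : MDifferentiableAt I 𝓘(ℝ, E) (extChartAt I u.proj) v.proj :=
    mdifferentiableAt_extChartAt hv
  have hd1' : MDifferentiableAt I.tangent 𝓘(ℝ, E)
      (fun w : TangentBundle I M => extChartAt I u.proj w.proj) v :=
    hd1.comp v (mdifferentiableAt_proj _)
  have hd2 := mdifferentiableAt_trivializationAt_snd (I := I) hv'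
  have h2 := mfderiv_prodMk hd1' hd2
  rw [← modelWithCornersSelf_prod, chartedSpaceSelf_prod] at h2
  refine (DFunLike.congr_fun (h1.trans h2) ξ).trans (Prod.ext ?_ rfl)
  refine (mvfderiv_comp_proj hd1 ξ).trans ?_
  exact (DFunLike.congr_fun (TangentBundle.continuousLinearMapAt_trivializationAt (I := I) hv)
    _).symm

/-- A vector field on `TM` is differentiable if its horizontal and vertical parts are lifts of
smooth vector fields. -/
theorem IsLeviCivita.mdifferentiableAt_of_proj_of_connectionMap [T2Space M]
    (h : IsLeviCivita (fun p x y => g.inner p x y) cov)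
    {A : Π v : TangentBundle I M, TangentSpace I.tangent v} {X Y : Π q : M, TangentSpace I q}
    (hX : IsSmoothField X) (hY : IsSmoothField Y)
    (hA : ∀ v, mfderiv I.tangent I (TotalSpace.proj : TangentBundle I M → M) v (A v) = X v.proj)
    (hA' : ∀ v, connectionMap cov v (A v) = Y v.proj) (u : TangentBundle I M) :
    MDifferentiableAt I.tangent I.tangent.tangent
      (fun v => (⟨v, A v⟩ : TangentBundle I.tangent (TangentBundle I M))) u := by
  refine mdifferentiableAt_vectorField_of_extChartAt ?_
  let e := trivializationAt E (TangentSpace I : M → Type _) u.proj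
  let b := Module.finBasis ℝ E
  have hu : u.proj ∈ e.baseSet := FiberBundle.mem_baseSet_trivializationAt' u.proj
  -- Global smooth fields that agree near `u.proj` with the frame of `e` defined by the basis `b`.
  choose S hS hSe using fun i => exists_contMDiff_eventuallyEq_extend (I := I)
    (e.symm u.proj (b i) : TangentSpace I u.proj)
  have hS' : ∀ i, IsSmoothField (S i) := hS
  have hSe' : ∀ᶠ q in 𝓝 u.proj, q ∈ e.baseSet ∧ ∀ i, S i q = e.symm q (b i) := by
    refine Filter.Eventually.and (e.open_baseSet.mem_nhds hu) (Filter.eventually_all.2 fun i => ?_)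
    filter_upwards [hSe i] with q hq
    rw [hq]
    change e.symm q (e ⟨u.proj, e.symm u.proj (b i)⟩).2 = _
    rw [e.apply_mk_symm hu]
  -- The frame identity is needed on a neighbourhood of `v.proj` for every `v` near `u`, since `∇ S
  -- i` is evaluated at `v.proj`.
  have hev : ∀ᶠ v in 𝓝 u, ∀ᶠ q in 𝓝 v.proj, q ∈ e.baseSet ∧ ∀ i, S i q = e.symm q (b i) :=
    (FiberBundle.continuous_proj E (TangentSpace I : M → Type _)).continuousAt.eventually
      hSe'.eventually_nhds
  have hL : ∀ {W : Π q : M, TangentSpace I q}, IsSmoothField W →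
      MDifferentiableAt I.tangent 𝓘(ℝ, E) (fun v : TangentBundle I M =>
        e.continuousLinearMapAt ℝ v.proj (W v.proj)) u := fun hW =>
    (hW.mdifferentiableAt_continuousLinearMapAt u.proj).comp u (mdifferentiableAt_proj _)
  have hψ : MDifferentiableAt I.tangent 𝓘(ℝ, E) (fun v : TangentBundle I M => (e v).2) u :=
    mdifferentiableAt_trivializationAt u
  have hc : ∀ i, MDifferentiableAt I.tangent 𝓘(ℝ, ℝ)
      (fun v : TangentBundle I M => b.repr (e v).2 i) u := fun i =>
    ((b.coord i).toContinuousLinearMap.differentiableAt.mdifferentiableAt).comp u hψ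
  -- The fibre coordinates of `A`: with `y^i` the coordinates of `v`, they are `e(Y) - ∑ y^i e(∇_X
  -- S_i)`, the invariant form of `-Γ_{ij}^k X^i y^j` plus the vertical part.
  have hfin : MDifferentiableAt I.tangent 𝓘(ℝ, E) (fun v : TangentBundle I M =>
      e.continuousLinearMapAt ℝ v.proj (Y v.proj) - ∑ i, b.repr (e v).2 i •
        e.continuousLinearMapAt ℝ v.proj (cov (S i) v.proj (X v.proj))) u := by
    refine (hL hY).sub ?_
    have : ∀ s : Finset (Fin (Module.finrank ℝ E)), MDifferentiableAt I.tangent 𝓘(ℝ, E)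
        (fun v : TangentBundle I M => ∑ i ∈ s, b.repr (e v).2 i •
        e.continuousLinearMapAt ℝ v.proj (cov (S i) v.proj (X v.proj))) u := fun s => by
      classical
      induction s using Finset.induction with
      | empty => simpa using mdifferentiableAt_const
      | insert i s hi ih =>
        simp only [Finset.sum_insert hi]
        exact ((hc i).smul (hL (h.isSmoothField hX (hS' i)))).add ih
    exact this _
  refine ((hL hX).prodMk_space hfin).congr_of_eventuallyEq ?_
  filter_upwards [hev] with v hv
  have hvb : v.proj ∈ e.baseSet := hv.self_of_nhds.1
  have hvs : v.proj ∈ (chartAt H u.proj).source := by simpa [e] using hvb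
  rw [mvfderiv_extChartAt_tangentBundle hvs, hA]
  refine Prod.ext rfl ?_
  refine (mvfderiv_trivializationAt_snd h hvb
    (IsSmoothField.sum_smul Finset.univ (fun i => b.repr (e v).2 i) hS') ?_ (A v)).trans ?_
  · filter_upwards [hv] with q hq
    have h1 : ∀ y : E, e.symm q y = e.symmL ℝ q y := fun y => (e.symmL_apply hq.1 y).symm
    change _ = e.symm q (e v).2
    rw [h1]
    conv_rhs => rw [← b.sum_repr (e v).2]
    rw [map_sum]
    refine Finset.sum_congr rfl fun i _ => ?_
    rw [map_smul, ← h1, hq.2 i]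
  · rw [hA, hA', CovariantDerivative.apply_sum_smul _ _ hS', map_sub, map_sum]
    simp only [map_smul]
    rfl

end LiftsAreDifferentiable

/-! ### Lie brackets of sums of lifts. -/

section BracketsOfLifts

variable {E : Type*} [NormedAddCommGroup E] [NormedSpace ℝ E]
  {H : Type*} [TopologicalSpace H] {I : ModelWithCorners ℝ E H}
  {M : Type*} [TopologicalSpace M] [ChartedSpace H M] [IsManifold I ∞ M]
  {g : ContMDiffRiemannianMetric I ∞ E (TangentSpace I : M → Type _)}
  {cov : CovariantDerivative I E (TangentSpace I : M → Type _)}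

theorem isSmoothField_zero : IsSmoothField (fun q : M => (0 : TangentSpace I q)) :=
  contMDiff_zeroSection ℝ (TangentSpace I : M → Type _)

/-- The vector field `A` on `TM` is the sum of the horizontal lift of `X` and the vertical lift
of `Y`, where `X` and `Y` are smooth. -/
structure IsLiftSum (cov : CovariantDerivative I E (TangentSpace I : M → Type _))
    (A : Π v : TangentBundle I M, TangentSpace I.tangent v) (X Y : Π q : M, TangentSpace I q) :
    Prop where
  horizontal : IsSmoothField X
  vertical : IsSmoothField Y
  proj : ∀ v, mfderiv I.tangent I (TotalSpace.proj : TangentBundle I M → M) v (A v) = X v.proj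
  conn : ∀ v, connectionMap cov v (A v) = Y v.proj

theorem isLiftSum_horizontalLift {X : Π q : M, TangentSpace I q} (hX : IsSmoothField X) :
    IsLiftSum cov (fun v => horizontalLift cov v (X v.proj)) X fun _ => 0 :=
  ⟨hX, isSmoothField_zero, fun v => mfderiv_proj_horizontalLift cov v _,
    fun v => connectionMap_horizontalLift cov v _⟩

theorem isLiftSum_verticalLift {Y : Π q : M, TangentSpace I q} (hY : IsSmoothField Y) :
    IsLiftSum cov (fun v => verticalLift v (Y v.proj)) (fun _ => 0) Y :=
  ⟨isSmoothField_zero, hY, fun v => mfderiv_proj_verticalLift v _,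
    fun v => connectionMap_verticalLift cov v _⟩

theorem exists_isLiftSum [FiniteDimensional ℝ E] [T2Space M] {u : TangentBundle I M}
    (z w : TangentSpace I u.proj) :
    ∃ C Z W, IsLiftSum cov C Z W ∧ Z u.proj = z ∧ W u.proj = w := by
  obtain ⟨Z, hZ, rfl⟩ := exists_isSmoothField_apply_eq (I := I) z
  obtain ⟨W, hW, rfl⟩ := exists_isSmoothField_apply_eq (I := I) w
  refine ⟨fun v => horizontalLift cov v (Z v.proj) + verticalLift v (W v.proj), Z, W,
    ⟨hZ, hW, fun v => ?_, fun v => ?_⟩, rfl, rfl⟩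
  · refine (map_add (mfderiv I.tangent I (TotalSpace.proj : TangentBundle I M → M) v) _ _).trans ?_
    rw [mfderiv_proj_horizontalLift, mfderiv_proj_verticalLift, add_zero]
  · rw [map_add, connectionMap_horizontalLift, connectionMap_verticalLift, zero_add]

variable {A B : Π v : TangentBundle I M, TangentSpace I.tangent v}
  {X Y X' Y' : Π q : M, TangentSpace I q}

theorem IsLiftSum.mdifferentiableAt [FiniteDimensional ℝ E] [T2Space M] (hA : IsLiftSum cov A X Y)
    (h : IsLeviCivita (fun p x y => g.inner p x y) cov) (u : TangentBundle I M) :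
    MDifferentiableAt I.tangent I.tangent.tangent
      (fun v => (⟨v, A v⟩ : TangentBundle I.tangent (TangentBundle I M))) u :=
  h.mdifferentiableAt_of_proj_of_connectionMap hA.horizontal hA.vertical hA.proj hA.conn u

/-- `A` and `B` are π-related to `X` and `X'`, hence so are the brackets. The commutator identity is
applied to `φ ∘ π` for a chart `φ` of the base, whose derivative is injective. -/
theorem IsLiftSum.mfderiv_proj_mlieBracket [FiniteDimensional ℝ E] [T2Space M] [I.Boundaryless]
    (hA : IsLiftSum cov A X Y) (hB : IsLiftSum cov B X' Y')
    (h : IsLeviCivita (fun p x y => g.inner p x y) cov) (u : TangentBundle I M) :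
    mfderiv I.tangent I (TotalSpace.proj : TangentBundle I M → M) u
      (VectorField.mlieBracket I.tangent A B u) = VectorField.mlieBracket I X X' u.proj := by
  let φ := extChartAt I u.proj
  have hφ : ContMDiffAt I 𝓘(ℝ, E) 2 φ u.proj := contMDiffAt_extChartAt
  have hφd : MDifferentiableAt I 𝓘(ℝ, E) φ u.proj := hφ.mdifferentiableAt (by norm_num)
  have hφπ : ContMDiffAt I.tangent 𝓘(ℝ, E) 2 (fun v : TangentBundle I M => φ v.proj) u :=
    ContMDiffAt.comp u hφ (contMDiff_proj _).contMDiffAt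
  have hsrc : (chartAt H u.proj).source ∈ 𝓝 u.proj :=
    (chartAt H u.proj).open_source.mem_nhds (mem_chart_source H u.proj)
  have hdX : ∀ {S : Π q : M, TangentSpace I q}, IsSmoothField S →
      MDifferentiableAt I 𝓘(ℝ, E) (fun q => mvfderiv I φ q (S q)) u.proj := fun {S} hS => by
    refine (hS.mdifferentiableAt_continuousLinearMapAt u.proj).congr_of_eventuallyEq ?_
    filter_upwards [hsrc] with q hq
    exact (DFunLike.congr_fun (TangentBundle.continuousLinearMapAt_trivializationAt (I := I) hq)
      (S q)).symm
  have hder : ∀ {C : Π v : TangentBundle I M, TangentSpace I.tangent v}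
      {S T : Π q : M, TangentSpace I q}, IsLiftSum cov C S T → ∀ ξ : TangentSpace I.tangent u,
      mvfderiv I.tangent (fun v => mvfderiv I.tangent (fun w : TangentBundle I M => φ w.proj) v
        (C v)) u ξ = mvfderiv I (fun q => mvfderiv I φ q (S q)) u.proj
          (mfderiv I.tangent I (TotalSpace.proj : TangentBundle I M → M) u ξ) :=
    fun {C S T} hC ξ => by
    have hev : (fun v => mvfderiv I.tangent (fun w : TangentBundle I M => φ w.proj) v (C v))
        =ᶠ[𝓝 u] fun v => mvfderiv I φ v.proj (S v.proj) := by
      have hs : {w : TangentBundle I M | w.proj ∈ (chartAt H u.proj).source} ∈ 𝓝 u :=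
        (FiberBundle.continuous_proj E (TangentSpace I : M → Type _)).continuousAt.preimage_mem_nhds
          hsrc
      filter_upwards [hs] with v hv
      rw [mvfderiv_comp_proj (mdifferentiableAt_extChartAt hv), hC.proj]
    rw [← mvfderiv_comp_proj (hdX hC.horizontal)]
    exact DFunLike.congr_fun (hev.mfderiv_eq (I := I.tangent) (I' := 𝓘(ℝ, E))) ξ
  have h1 := mvfderiv_mlieBracket hφπ (hA.mdifferentiableAt h u) (hB.mdifferentiableAt h u)
  rw [mvfderiv_comp_proj hφd, hder hA, hder hB, hA.proj, hB.proj,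
    ← mvfderiv_mlieBracket hφ (hA.horizontal.mdifferentiableAt _)
      (hB.horizontal.mdifferentiableAt _)] at h1
  exact (isInvertible_mfderiv_extChartAt (I := I) (mem_extChartAt_source (I := I) u.proj)).injective
    h1

/-- The derivative of the fibrewise linear function `v ↦ g(Z, v)` along a sum of lifts. -/
theorem IsLiftSum.mvfderiv_inner_snd [FiniteDimensional ℝ E] (hA : IsLiftSum cov A X Y)
    (h : IsLeviCivita (fun p x y => g.inner p x y) cov) {Z : Π p : M, TangentSpace I p}
    (hZ : IsSmoothField Z) (u : TangentBundle I M) :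
    mvfderiv I.tangent (fun v : TangentBundle I M => g.inner v.proj (Z v.proj) v.snd) u (A u) =
      g.inner u.proj (cov Z u.proj (X u.proj)) u.snd
        + g.inner u.proj (Z u.proj) (Y u.proj) := by
  rw [h.mvfderiv_inner_snd hZ, hA.proj, hA.conn]

theorem IsLiftSum.mvfderiv_inner_comp_proj (hA : IsLiftSum cov A X Y)
    (h : IsLeviCivita (fun p x y => g.inner p x y) cov) {S T : Π p : M, TangentSpace I p}
    (hS : IsSmoothField S) (hT : IsSmoothField T) (u : TangentBundle I M) :
    mvfderiv I.tangent (fun v : TangentBundle I M => g.inner v.proj (S v.proj) (T v.proj)) u (A u) =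
      g.inner u.proj (cov S u.proj (X u.proj)) (T u.proj)
        + g.inner u.proj (S u.proj) (cov T u.proj (X u.proj)) := by
  rw [mvfderiv_comp_proj (f := fun q => g.inner q (S q) (T q)) (hS.mdifferentiableAt_inner hT _),
    hA.proj, h.mvfderiv_inner hS hT]

theorem mdifferentiableAt_inner_comp_proj {S T : Π p : M, TangentSpace I p}
    (hS : IsSmoothField S) (hT : IsSmoothField T) (u : TangentBundle I M) :
    MDifferentiableAt I.tangent 𝓘(ℝ, ℝ)
      (fun v : TangentBundle I M => g.inner v.proj (S v.proj) (T v.proj)) u :=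
  (hS.mdifferentiableAt_inner hT u.proj).comp u (mdifferentiableAt_proj _)

/-- Apply the commutator identity to `v ↦ g(Z, v)`. The terms pairing `∇Z` with `Y` and `Y'` cancel
by symmetry, the second derivatives of `Z` assemble into `g(R_{XX'} Z, u)`, and skew-symmetry turns
this into `-g(R_{XX'} u, Z)`. -/
theorem IsLiftSum.connectionMap_mlieBracket [FiniteDimensional ℝ E] [T2Space M] [I.Boundaryless]
    (hA : IsLiftSum cov A X Y) (hB : IsLiftSum cov B X' Y')
    (h : IsLeviCivita (fun p x y => g.inner p x y) cov) (u : TangentBundle I M) :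
    connectionMap cov u (VectorField.mlieBracket I.tangent A B u) =
      cov Y' u.proj (X u.proj) - cov Y u.proj (X' u.proj)
        - curvature cov u.proj (X u.proj) (X' u.proj) u.snd := by
  refine ContMDiffRiemannianMetric.eq_of_forall_inner g fun z => ?_
  obtain ⟨Z, hZ, rfl⟩ := exists_isSmoothField_apply_eq (I := I) z
  have second : ∀ {C D : Π v : TangentBundle I M, TangentSpace I.tangent v}
      {S T S' T' : Π q : M, TangentSpace I q}, IsLiftSum cov C S T → IsLiftSum cov D S' T' →
      mvfderiv I.tangent (fun v => mvfderiv I.tangent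
        (fun v : TangentBundle I M => g.inner v.proj (Z v.proj) v.snd) v (D v)) u (C u) =
      g.inner u.proj (cov (fun q => cov Z q (S' q)) u.proj (S u.proj)) u.snd
        + g.inner u.proj (cov Z u.proj (S' u.proj)) (T u.proj)
        + (g.inner u.proj (cov Z u.proj (S u.proj)) (T' u.proj)
          + g.inner u.proj (Z u.proj) (cov T' u.proj (S u.proj))) :=
    fun {C D S T S' T'} hC hD => by
    have hs := h.isSmoothField hD.horizontal hZ
    rw [funext fun v => hD.mvfderiv_inner_snd h hZ v, mvfderiv_fun_add
      (mdifferentiableAt_inner_snd hs u) (mdifferentiableAt_inner_comp_proj hZ hD.vertical u),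
      add_apply, hC.mvfderiv_inner_snd h hs, hC.mvfderiv_inner_comp_proj h hZ hD.vertical]
  have h1 := mvfderiv_mlieBracket (x := u)
    ((contMDiff_inner_snd (g := g) hZ u).of_le ENat.LEInfty.out)
    (hA.mdifferentiableAt h u) (hB.mdifferentiableAt h u)
  rw [second hA hB, second hB hA, h.mvfderiv_inner_snd hZ,
    hA.mfderiv_proj_mlieBracket hB h] at h1
  have h2 := h.inner_curvature_skew u.proj (X u.proj) (X' u.proj) (Z u.proj) u.snd
  rw [h.curvature_apply hA.horizontal hB.horizontal hZ] at h2
  simp only [curvatureOfFields, map_sub, sub_apply] at h2 ⊢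
  rw [g.symm u.proj _ (Z u.proj), g.symm u.proj _ (Z u.proj), g.symm u.proj _ (Z u.proj),
    g.symm u.proj _ (Z u.proj)]
  rw [g.symm u.proj _ (Z u.proj)] at h2
  linarith

end BracketsOfLifts

/-! ### The Koszul formula. -/

section Koszul

variable {E : Type*} [NormedAddCommGroup E] [NormedSpace ℝ E]
  {H : Type*} [TopologicalSpace H] {I : ModelWithCorners ℝ E H}
  {M : Type*} [TopologicalSpace M] [ChartedSpace H M] [IsManifold I 1 M]

/-- The Koszul formula. -/
theorem IsLeviCivita.koszul {G : Π p : M, TangentSpace I p → TangentSpace I p → ℝ}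
    {cov : CovariantDerivative I E (TangentSpace I : M → Type _)} (h : IsLeviCivita G cov)
    (hsymm : ∀ p x y, G p x y = G p y x) (hsub : ∀ p x y z, G p (x - y) z = G p x z - G p y z)
    {A B C : Π p : M, TangentSpace I p} {p : M}
    (hA : MDifferentiableAt I I.tangent (fun q => (⟨q, A q⟩ : TangentBundle I M)) p)
    (hB : MDifferentiableAt I I.tangent (fun q => (⟨q, B q⟩ : TangentBundle I M)) p)
    (hC : MDifferentiableAt I I.tangent (fun q => (⟨q, C q⟩ : TangentBundle I M)) p) :
    2 * G p (cov B p (A p)) (C p) =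
      mvfderiv I (fun q => G q (B q) (C q)) p (A p)
        + mvfderiv I (fun q => G q (A q) (C q)) p (B p)
        - mvfderiv I (fun q => G q (A q) (B q)) p (C p)
        + G p (VectorField.mlieBracket I A B p) (C p)
        - G p (VectorField.mlieBracket I A C p) (B p)
        - G p (VectorField.mlieBracket I B C p) (A p) := by
  rw [h.metric B C p _ hB hC, h.metric A C p _ hA hC, h.metric A B p _ hA hB,
    ← h.torsion_free A B p hA hB, ← h.torsion_free A C p hA hC, ← h.torsion_free B C p hB hC,
    hsub, hsub, hsub, hsymm p (B p), hsymm p (A p), hsymm p (A p)]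
  ring

end Koszul

/-! ### Nondegeneracy of `g_A` and derivatives of its values on lifts. -/

section MetricOnTangentBundle

variable {E : Type*} [NormedAddCommGroup E] [NormedSpace ℝ E]
  {H : Type*} [TopologicalSpace H] {I : ModelWithCorners ℝ E H}
  {M : Type*} [TopologicalSpace M] [ChartedSpace H M] [IsManifold I ∞ M]
  {g : ContMDiffRiemannianMetric I ∞ E (TangentSpace I : M → Type _)}
  {cov : CovariantDerivative I E (TangentSpace I : M → Type _)} {a b : ℝ → ℝ}

theorem gA_symm (u : TangentBundle I M) (ξ η : TangentSpace I.tangent u) :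
    gA g cov a b u ξ η = gA g cov a b u η ξ := by
  simp only [gA]
  rw [g.symm u.proj (mfderiv I.tangent I (TotalSpace.proj : TangentBundle I M → M) u ξ),
    g.symm u.proj (connectionMap cov u ξ) (connectionMap cov u η)]
  ring

theorem gA_sub_left (u : TangentBundle I M) (ξ η ζ : TangentSpace I.tangent u) :
    gA g cov a b u (ξ - η) ζ = gA g cov a b u ξ ζ - gA g cov a b u η ζ := by
  simp only [gA, map_sub, sub_apply]
  ring

theorem ContMDiffRiemannianMetric.inner_self_nonneg {p : M} (x : TangentSpace I p) :
    0 ≤ g.inner p x x := by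
  by_cases hx : x = 0
  · simp [hx]
  · exact (g.pos p x hx).le

/-- The metric `g_A` is nondegenerate. -/
theorem eq_of_forall_gA (ha : ∀ t, 0 ≤ t → 0 < a t) (hab : ∀ t, 0 ≤ t → 0 < a t + 2 * t * b t)
    [FiniteDimensional ℝ E] {u : TangentBundle I M} {ξ η : TangentSpace I.tangent u}
    (h : ∀ ζ, gA g cov a b u ξ ζ = gA g cov a b u η ζ) : ξ = η := by
  have ht : 0 ≤ g.inner u.proj u.snd u.snd / 2 :=
    div_nonneg (ContMDiffRiemannianMetric.inner_self_nonneg _) (by norm_num)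
  have h0 : ∀ ζ, gA g cov a b u (ξ - η) ζ = 0 := fun ζ => by rw [gA_sub_left, h, sub_self]
  have h1 : ∀ x, g.inner u.proj
      (mfderiv I.tangent I (TotalSpace.proj : TangentBundle I M → M) u (ξ - η)) x = 0 := fun x => by
    have := h0 (horizontalLift cov u x)
    simpa [gA, mfderiv_proj_horizontalLift, connectionMap_horizontalLift] using this
  have h2 : ∀ y, a (g.inner u.proj u.snd u.snd / 2) * g.inner u.proj
      (connectionMap cov u (ξ - η)) y + b (g.inner u.proj u.snd u.snd / 2) *
        (g.inner u.proj (connectionMap cov u (ξ - η)) u.snd * g.inner u.proj y u.snd) = 0 :=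
    fun y => by
    have := h0 (verticalLift u y)
    simpa only [gA, mfderiv_proj_verticalLift, connectionMap_verticalLift, map_zero,
      zero_add] using this
  have h3 : g.inner u.proj (connectionMap cov u (ξ - η)) u.snd = 0 := by
    -- Pairing with `u` itself, where `g(u, u) = 2t`, produces the factor `a + 2tb`. Its positivity
    -- kills the `u`-component first; positivity of `a` then kills the rest.
    have h4 := h2 u.snd
    have h5 := hab _ ht
    have h6 : (a (g.inner u.proj u.snd u.snd / 2) + 2 * (g.inner u.proj u.snd u.snd / 2) *
      b (g.inner u.proj u.snd u.snd / 2)) *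
        g.inner u.proj (connectionMap cov u (ξ - η)) u.snd = 0 := by linarith
    exact (mul_eq_zero.1 h6).resolve_left h5.ne'
  have h7 : connectionMap cov u (ξ - η) = 0 :=
    ContMDiffRiemannianMetric.eq_of_forall_inner g fun y => by
      have h8 := h2 y
      rw [h3, zero_mul, mul_zero, add_zero] at h8
      rw [(mul_eq_zero.1 h8).resolve_left (ha _ ht).ne', map_zero, zero_apply]
  have h9 : mfderiv I.tangent I (TotalSpace.proj : TangentBundle I M → M) u (ξ - η) = 0 :=
    ContMDiffRiemannianMetric.eq_of_forall_inner g fun y => by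
      rw [h1, map_zero, zero_apply]
  refine sub_eq_zero.1 (tangentBundle_tangent_ext cov u ?_ ?_)
  · exact h9.trans (map_zero _).symm
  · exact h7.trans (map_zero _).symm

/-- Only one-sided regularity of `f` at 0 is available. It suffices because `g(v, v)` takes values
in `[0, ∞)`, so the chain rule within `Ici 0` yields an unrestricted derivative on `TM`, zero
section included. -/
theorem hasMFDerivAt_comp_half_inner_snd_snd {f : ℝ → ℝ} (hf : ContDiffOn ℝ ∞ f (Ici 0))
    (u : TangentBundle I M) :
    HasMFDerivAt I.tangent 𝓘(ℝ, ℝ)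
      (fun v : TangentBundle I M => f (g.inner v.proj v.snd v.snd / 2)) u
      ((ContinuousLinearMap.toSpanSingleton ℝ
        (derivWithin f (Ici 0) (g.inner u.proj u.snd u.snd / 2) / 2)).comp
      (mvfderiv I.tangent (fun v : TangentBundle I M => g.inner v.proj v.snd v.snd) u)) := by
  have h0 : ∀ v : TangentBundle I M, g.inner v.proj v.snd v.snd / 2 ∈ Ici (0 : ℝ) := fun v =>
    div_nonneg (ContMDiffRiemannianMetric.inner_self_nonneg _) (by norm_num)
  have h1 := ((hf.differentiableOn (by simp)) _ (h0 u)).hasDerivWithinAt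
  have h2 : HasDerivAt (fun s : ℝ => s / 2) (1 / 2) (g.inner u.proj u.snd u.snd) := by
    simpa using (hasDerivAt_id (g.inner u.proj u.snd u.snd)).div_const 2
  have h3 : HasDerivWithinAt (fun s : ℝ => f (s / 2))
      (derivWithin f (Ici 0) (g.inner u.proj u.snd u.snd / 2) * (1 / 2)) (Ici 0)
      (g.inner u.proj u.snd u.snd) := by
    refine HasDerivWithinAt.comp (h := fun s : ℝ => s / 2) (h₂ := f) _ h1 h2.hasDerivWithinAt
      fun s hs => ?_
    exact div_nonneg (mem_Ici.1 hs) (by norm_num)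
  have h4 := h3.hasFDerivWithinAt.hasMFDerivWithinAt
  have h5 := (mdifferentiableAt_inner_snd_snd (g := g) u).hasMFDerivAt.hasMFDerivWithinAt (s := univ)
  have h6 := HasMFDerivWithinAt.comp u h4 h5 fun v _ =>
    ContMDiffRiemannianMetric.inner_self_nonneg _
  rw [hasMFDerivWithinAt_univ, mul_one_div] at h6
  exact h6

theorem mdifferentiableAt_comp_half_inner_snd_snd {f : ℝ → ℝ} (hf : ContDiffOn ℝ ∞ f (Ici 0))
    (u : TangentBundle I M) : MDifferentiableAt I.tangent 𝓘(ℝ, ℝ)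
      (fun v : TangentBundle I M => f (g.inner v.proj v.snd v.snd / 2)) u :=
  (hasMFDerivAt_comp_half_inner_snd_snd hf u).mdifferentiableAt

variable {A B C : Π v : TangentBundle I M, TangentSpace I.tangent v}
  {X Y X' Y' Z W : Π q : M, TangentSpace I q}

theorem IsLiftSum.mvfderiv_comp_half_inner_snd_snd [FiniteDimensional ℝ E]
    (hC : IsLiftSum cov C Z W)
    (h : IsLeviCivita (fun p x y => g.inner p x y) cov) {f : ℝ → ℝ}
    (hf : ContDiffOn ℝ ∞ f (Ici 0)) (u : TangentBundle I M) :
    mvfderiv I.tangent (fun v : TangentBundle I M => f (g.inner v.proj v.snd v.snd / 2)) u (C u) =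
      derivWithin f (Ici 0) (g.inner u.proj u.snd u.snd / 2)
        * g.inner u.proj (W u.proj) u.snd := by
  have h1 := DFunLike.congr_fun (hasMFDerivAt_comp_half_inner_snd_snd (g := g) hf u).mfderiv (C u)
  refine Eq.trans h1 ?_
  change mvfderiv I.tangent (fun v : TangentBundle I M => g.inner v.proj v.snd v.snd) u (C u)
    * (derivWithin f (Ici 0) (g.inner u.proj u.snd u.snd / 2) / 2) = _
  rw [h.mvfderiv_inner_snd_snd, hC.conn]
  ring

theorem IsLiftSum.gA_apply (hB : IsLiftSum cov B X' Y') (u : TangentBundle I M)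
    (ξ : TangentSpace I.tangent u) :
    gA g cov a b u ξ (B u) =
      g.inner u.proj (mfderiv I.tangent I (TotalSpace.proj : TangentBundle I M → M) u ξ) (X' u.proj)
      + a (g.inner u.proj u.snd u.snd / 2) *
        g.inner u.proj (connectionMap cov u ξ) (Y' u.proj)
      + b (g.inner u.proj u.snd u.snd / 2) * (g.inner u.proj (connectionMap cov u ξ) u.snd
        * g.inner u.proj (Y' u.proj) u.snd) := by
  simp only [gA, hB.proj, hB.conn]

/-- The derivative of the function `g_A(A, B)` along `C`, for sums of lifts `A`, `B`, `C`. -/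
theorem IsLiftSum.mvfderiv_gA [FiniteDimensional ℝ E]
    (hA : IsLiftSum cov A X Y) (hB : IsLiftSum cov B X' Y') (hC : IsLiftSum cov C Z W)
    (h : IsLeviCivita (fun p x y => g.inner p x y) cov)
    (ha : ContDiffOn ℝ ∞ a (Ici 0)) (hb : ContDiffOn ℝ ∞ b (Ici 0)) (u : TangentBundle I M) :
    let gp := g.inner u.proj
    let p := u.proj
    let t : ℝ := gp u.snd u.snd / 2
    mvfderiv I.tangent (fun v => gA g cov a b v (A v) (B v)) u (C u) =
      gp (cov X p (Z p)) (X' p) + gp (X p) (cov X' p (Z p))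
      + (a t * (gp (cov Y p (Z p)) (Y' p) + gp (Y p) (cov Y' p (Z p)))
        + gp (Y p) (Y' p) * (derivWithin a (Ici 0) t * gp (W p) u.snd))
      + (b t * (gp (Y p) u.snd * (gp (cov Y' p (Z p)) u.snd + gp (Y' p) (W p))
          + gp (Y' p) u.snd * (gp (cov Y p (Z p)) u.snd + gp (Y p) (W p)))
        + gp (Y p) u.snd * gp (Y' p) u.snd * (derivWithin b (Ici 0) t * gp (W p) u.snd)) := by
  intro gp p t
  have e : (fun v => gA g cov a b v (A v) (B v)) = fun v : TangentBundle I M =>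
      (g.inner v.proj (X v.proj) (X' v.proj)
      + a (g.inner v.proj v.snd v.snd / 2) * g.inner v.proj (Y v.proj) (Y' v.proj))
      + b (g.inner v.proj v.snd v.snd / 2) *
        (g.inner v.proj (Y v.proj) v.snd * g.inner v.proj (Y' v.proj) v.snd) :=
    funext fun v => by rw [hB.gA_apply, hA.proj, hA.conn]
  have d1 := mdifferentiableAt_inner_comp_proj (g := g) hA.horizontal hB.horizontal u
  have d2 := mdifferentiableAt_inner_comp_proj (g := g) hA.vertical hB.vertical u
  have d3 := mdifferentiableAt_inner_snd (g := g) hA.vertical u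
  have d4 := mdifferentiableAt_inner_snd (g := g) hB.vertical u
  have da := mdifferentiableAt_comp_half_inner_snd_snd (g := g) ha u
  have db := mdifferentiableAt_comp_half_inner_snd_snd (g := g) hb u
  have da2 := da.mul d2
  have d34 := d3.mul d4
  have db34 := db.mul d34
  have d12 := d1.add da2
  simp only [Pi.mul_def, Pi.add_def] at da2 d34 db34 d12
  rw [e, mvfderiv_fun_add d12 db34, mvfderiv_fun_add d1 da2,
    mvfderiv_fun_mul da d2, mvfderiv_fun_mul db d34, mvfderiv_fun_mul d3 d4]
  simp only [add_apply, smul_apply, smul_eq_mul]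
  rw [hC.mvfderiv_inner_comp_proj h hA.horizontal hB.horizontal,
    hC.mvfderiv_inner_comp_proj h hA.vertical hB.vertical, hC.mvfderiv_inner_snd h hA.vertical,
    hC.mvfderiv_inner_snd h hB.vertical, hC.mvfderiv_comp_half_inner_snd_snd h ha,
    hC.mvfderiv_comp_half_inner_snd_snd h hb]

end MetricOnTangentBundle

/-! ### The Levi-Civita connection of `g_A` on sums of lifts. -/

section LeviCivitaOnTangentBundle

variable {E : Type*} [NormedAddCommGroup E] [NormedSpace ℝ E] [FiniteDimensional ℝ E]
  {H : Type*} [TopologicalSpace H] {I : ModelWithCorners ℝ E H} [I.Boundaryless]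
  {M : Type*} [TopologicalSpace M] [T2Space M] [ChartedSpace H M] [IsManifold I ∞ M]
  {g : ContMDiffRiemannianMetric I ∞ E (TangentSpace I : M → Type _)}
  {cov : CovariantDerivative I E (TangentSpace I : M → Type _)} {a b : ℝ → ℝ}
  {A B C : Π v : TangentBundle I M, TangentSpace I.tangent v}
  {X Y X' Y' Z W : Π q : M, TangentSpace I q}

/-- The `b`-term contains no curvature because `g(R_{XX'} u, u) = 0`. The bracket on `M` is expanded
by torsion-freeness so that it cancels against covariant derivatives in the Koszul formula. -/
theorem IsLiftSum.gA_mlieBracket (hA : IsLiftSum cov A X Y) (hB : IsLiftSum cov B X' Y')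
    (hC : IsLiftSum cov C Z W) (h : IsLeviCivita (fun p x y => g.inner p x y) cov)
    (u : TangentBundle I M) :
    let gp := g.inner u.proj
    let p := u.proj
    let t : ℝ := gp u.snd u.snd / 2
    gA g cov a b u (VectorField.mlieBracket I.tangent A B u) (C u) =
      gp (cov X' p (X p)) (Z p) - gp (cov X p (X' p)) (Z p)
      + a t * (gp (cov Y' p (X p)) (W p) - gp (cov Y p (X' p)) (W p)
        - gp (curvature cov p (X p) (X' p) u.snd) (W p))
      + b t * ((gp (cov Y' p (X p)) u.snd - gp (cov Y p (X' p)) u.snd) * gp (W p) u.snd) := by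
  intro gp p t
  have h0 := h.inner_curvature_skew p (X p) (X' p) u.snd u.snd
  have h1 : g.inner p (curvature cov p (X p) (X' p) u.snd) u.snd = 0 := by linarith
  rw [hC.gA_apply, hA.mfderiv_proj_mlieBracket hB h, hA.connectionMap_mlieBracket hB h,
    ← h.torsion_free X X' u.proj (hA.horizontal.mdifferentiableAt _)
      (hB.horizontal.mdifferentiableAt _)]
  simp only [map_sub, sub_apply]
  rw [h1]
  simp only [gp, p, t]
  ring

/-- The Levi-Civita connection of `g_A` on sums of horizontal and vertical lifts. -/
theorem IsLiftSum.leviCivita_gA (hA : IsLiftSum cov A X Y) (hB : IsLiftSum cov B X' Y')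
    (h : IsLeviCivita (fun p x y => g.inner p x y) cov)
    (ha : ContDiffOn ℝ ∞ a (Ici 0)) (hb : ContDiffOn ℝ ∞ b (Ici 0))
    (ha_pos : ∀ t, 0 ≤ t → 0 < a t) (hab_pos : ∀ t, 0 ≤ t → 0 < a t + 2 * t * b t)
    {covA : CovariantDerivative I.tangent (E × E)
      (TangentSpace I.tangent : TangentBundle I M → Type _)}
    (hcovA : IsLeviCivita (gA g cov a b) covA) (u : TangentBundle I M) :
    let p : M := u.proj
    let gp := g.inner p
    let R := curvature cov p
    let t : ℝ := gp u.snd u.snd / 2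
    let a' : ℝ := derivWithin a (Ici 0) t
    let b' : ℝ := derivWithin b (Ici 0) t
    let L : ℝ := a' / (2 * a t)
    let M' : ℝ := (2 * b t - a') / (2 * (a t + 2 * t * b t))
    let N : ℝ := (a t * b' - 2 * a' * b t) / (2 * a t * (a t + 2 * t * b t))
    covA B u (A u) =
      horizontalLift cov u (cov X' p (X p)
        + (a t / 2) • (R u.snd (Y' p) (X p) + R u.snd (Y p) (X' p)))
      + verticalLift u (cov Y' p (X p) - (1 / 2 : ℝ) • R (X p) (X' p) u.snd
        + L • (gp (Y p) u.snd • Y' p + gp (Y' p) u.snd • Y p)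
        + (M' * gp (Y p) (Y' p) + N * gp (Y p) u.snd * gp (Y' p) u.snd) • u.snd) := by
  intro p gp R t a' b' L M' N
  refine eq_of_forall_gA (g := g) (cov := cov) ha_pos hab_pos fun ζ => ?_
  obtain ⟨C, Z, W, hC, hZ, hW⟩ := exists_isLiftSum (cov := cov)
    (mfderiv I.tangent I (TotalSpace.proj : TangentBundle I M → M) u ζ) (connectionMap cov u ζ)
  have hCu : C u = ζ := tangentBundle_tangent_ext cov u ((hC.proj u).trans hZ)
    ((hC.conn u).trans hW)
  rw [← hCu]
  clear hCu hZ hW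
  have ht : 0 ≤ t := div_nonneg (ContMDiffRiemannianMetric.inner_self_nonneg _) (by norm_num)
  have hat : a t ≠ 0 := (ha_pos t ht).ne'
  have hSt : a t + 2 * t * b t ≠ 0 := (hab_pos t ht).ne'
  have hU : gp u.snd u.snd = 2 * t := by simp only [t]; ring
  -- The next three identities are the system defining `L`, `M'`, `N`: they match the coefficients
  -- of `g(Y, u) g(Y', W) + g(Y', u) g(Y, W)`, of `g(Y, Y') g(W, u)` and of `g(Y, u) g(Y', u) g(W,
  -- u)` in the Koszul formula. The factor `a + 2tb` arises from pairing `u` with `W` under `g_A`.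
  have hL : 2 * a t * L = a' := by simp only [L]; field_simp
  have hM : 2 * M' * (a t + 2 * t * b t) = 2 * b t - a' := by
    have key : ∀ S x : ℝ, S ≠ 0 → 2 * (x / (2 * S)) * S = x := fun S x hS => by field_simp
    exact key _ _ hSt
  have hN : 4 * b t * L + 2 * N * (a t + 2 * t * b t) = b' := by
    have key : ∀ S α β α' β' : ℝ, S ≠ 0 → α ≠ 0 →
        4 * β * (α' / (2 * α)) + 2 * ((α * β' - 2 * α' * β) / (2 * α * S)) * S = β' :=
      fun S α β α' β' hS hα => by field_simp; ring
    exact key _ _ _ _ _ hSt hat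
  have hK := hcovA.koszul gA_symm gA_sub_left (hA.mdifferentiableAt h u)
    (hB.mdifferentiableAt h u) (hC.mdifferentiableAt h u)
  rw [hB.mvfderiv_gA hC hA h ha hb, hA.mvfderiv_gA hC hB h ha hb, hA.mvfderiv_gA hB hC h ha hb,
    hA.gA_mlieBracket hB hC h, hA.gA_mlieBracket hC hB h, hB.gA_mlieBracket hC hA h] at hK
  have hπ := (map_add (mfderiv I.tangent I (TotalSpace.proj : TangentBundle I M → M) u)
    (horizontalLift cov u (cov X' p (X p)
        + (a t / 2) • (R u.snd (Y' p) (X p) + R u.snd (Y p) (X' p))))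
    (verticalLift u (cov Y' p (X p) - (1 / 2 : ℝ) • R (X p) (X' p) u.snd
        + L • (gp (Y p) u.snd • Y' p + gp (Y' p) u.snd • Y p)
        + (M' * gp (Y p) (Y' p) + N * gp (Y p) u.snd * gp (Y' p) u.snd) • u.snd)))
  rw [mfderiv_proj_horizontalLift, mfderiv_proj_verticalLift, add_zero] at hπ
  rw [hC.gA_apply u (_ + _), hπ, map_add (connectionMap cov u), connectionMap_horizontalLift,
    connectionMap_verticalLift, zero_add]
  -- The brackets with the test field contribute curvature with `Z` in the second slot; pair
  -- symmetry isolates `Z`.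
  have c1 : gp (R u.snd (Y' p) (X p)) (Z p) = gp (R (X p) (Z p) u.snd) (Y' p) :=
    h.inner_curvature_pair p _ _ _ _
  have c2 : gp (R u.snd (Y p) (X' p)) (Z p) = gp (R (X' p) (Z p) u.snd) (Y p) :=
    h.inner_curvature_pair p _ _ _ _
  have r0 : gp (R (X p) (X' p) u.snd) u.snd = 0 := by
    have := h.inner_curvature_skew p (X p) (X' p) u.snd u.snd
    simp only [gp, R]
    linarith
  change 2 * gA g cov a b u (covA B u (A u)) (C u) = _ at hK
  change _ = gp _ (Z p) + a t * gp _ (W p) + b t * (gp _ u.snd * gp (W p) u.snd)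
  simp only [map_add, map_sub, map_smul, add_apply, sub_apply, smul_apply, smul_eq_mul]
  rw [c1, c2, r0, hU, g.symm p u.snd (W p)]
  rw [g.symm p (X' p) (cov Z p (X p)), g.symm p (Y' p) (cov W p (X p)),
    g.symm p (X p) (cov Z p (X' p)), g.symm p (Y p) (cov W p (X' p)),
    g.symm p (X p) (cov X' p (Z p)), g.symm p (Y p) (cov Y' p (Z p)),
    g.symm p (W p) (Y p), g.symm p (W p) (Y' p), g.symm p (Y' p) (Y p)] at hK
  -- The factor 1/2 undoes the 2 in the Koszul formula; the other multipliers are the monomials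
  -- whose coefficients `hL`, `hM`, `hN` match.
  linear_combination (1 / 2 : ℝ) * hK
    - (1 / 2 : ℝ) * (gp (Y p) u.snd * gp (Y' p) (W p) + gp (Y' p) u.snd * gp (Y p) (W p)) * hL
    - (1 / 2 : ℝ) * gp (Y p) (Y' p) * gp (W p) u.snd * hM
    - (1 / 2 : ℝ) * gp (Y p) u.snd * gp (Y' p) u.snd * gp (W p) u.snd * hN

end LeviCivitaOnTangentBundle

/-! ### Vanishing of curvature and covariant derivative on zero arguments. -/

section ZeroArguments

variable {E : Type*} [NormedAddCommGroup E] [NormedSpace ℝ E] [FiniteDimensional ℝ E]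
  {H : Type*} [TopologicalSpace H] {I : ModelWithCorners ℝ E H} [I.Boundaryless]
  {M : Type*} [TopologicalSpace M] [T2Space M] [ChartedSpace H M] [IsManifold I ∞ M]
  {g : ContMDiffRiemannianMetric I ∞ E (TangentSpace I : M → Type _)}
  {cov : CovariantDerivative I E (TangentSpace I : M → Type _)}

/-- No multilinearity of `curvature` is invoked: here, as for the other two slots, the symmetries
move the zero to a place where linearity of `g` applies. -/
theorem IsLeviCivita.curvature_zero_right (h : IsLeviCivita (fun p x y => g.inner p x y) cov)
    (p : M) (x y : TangentSpace I p) : curvature cov p x y 0 = 0 :=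
  ContMDiffRiemannianMetric.eq_of_forall_inner (g := g) fun w => by
    rw [h.inner_curvature_skew]; simp

theorem IsLeviCivita.curvature_zero_middle (h : IsLeviCivita (fun p x y => g.inner p x y) cov)
    (p : M) (x z : TangentSpace I p) : curvature cov p x 0 z = 0 :=
  ContMDiffRiemannianMetric.eq_of_forall_inner (g := g) fun w => by
    rw [h.inner_curvature_pair]; simp

theorem IsLeviCivita.curvature_zero_left (h : IsLeviCivita (fun p x y => g.inner p x y) cov)
    (p : M) (y z : TangentSpace I p) : curvature cov p 0 y z = 0 :=
  ContMDiffRiemannianMetric.eq_of_forall_inner (g := g) fun w => by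
    rw [h.inner_curvature_pair, h.curvature_zero_right]; simp

omit [FiniteDimensional ℝ E] [I.Boundaryless] [T2Space M] in
theorem CovariantDerivative.zero_field_apply (p : M) (x : TangentSpace I p) :
    cov (fun _ => 0) p x = 0 :=
  DFunLike.congr_fun (congrFun cov.zero p) x

end ZeroArguments

/-! ### The four covariant derivatives of lifts. -/

theorem proposition2p11
    {E : Type*} [NormedAddCommGroup E] [NormedSpace ℝ E] [FiniteDimensional ℝ E]
    {H : Type*} [TopologicalSpace H] {I : ModelWithCorners ℝ E H} [I.Boundaryless]
    {M : Type*} [TopologicalSpace M] [T2Space M] [ChartedSpace H M] [IsManifold I ∞ M]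
    (g : ContMDiffRiemannianMetric I ∞ E (TangentSpace I : M → Type _))
    (nabla : CovariantDerivative I E (TangentSpace I : M → Type _))
    (hnabla : IsLeviCivita (fun p x y => g.inner p x y) nabla)
    (a b : ℝ → ℝ) (ha : ContDiffOn ℝ ∞ a (Ici 0)) (hb : ContDiffOn ℝ ∞ b (Ici 0))
    (ha_pos : ∀ t, 0 ≤ t → 0 < a t) (hab_pos : ∀ t, 0 ≤ t → 0 < a t + 2 * t * b t)
    (nablaA : CovariantDerivative I.tangent (E × E)
      (TangentSpace I.tangent : TangentBundle I M → Type _))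
    (hnablaA : IsLeviCivita (gA g nabla a b) nablaA)
    (X Y : Π p : M, TangentSpace I p)
    (hX : ContMDiff I I.tangent ∞ (fun p => (⟨p, X p⟩ : TangentBundle I M)))
    (hY : ContMDiff I I.tangent ∞ (fun p => (⟨p, Y p⟩ : TangentBundle I M)))
    (u : TangentBundle I M) :
    let XH : Π v : TangentBundle I M, TangentSpace I.tangent v :=
      fun v => horizontalLift nabla v (X v.proj)
    let XV : Π v : TangentBundle I M, TangentSpace I.tangent v :=
      fun v => verticalLift v (X v.proj)
    let YH : Π v : TangentBundle I M, TangentSpace I.tangent v :=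
      fun v => horizontalLift nabla v (Y v.proj)
    let YV : Π v : TangentBundle I M, TangentSpace I.tangent v :=
      fun v => verticalLift v (Y v.proj)
    let p : M := u.proj
    let gp := g.inner p
    let R := curvature nabla p
    let t : ℝ := gp u.snd u.snd / 2
    let a' : ℝ := derivWithin a (Ici 0) t
    let b' : ℝ := derivWithin b (Ici 0) t
    let L : ℝ := a' / (2 * a t)
    let M' : ℝ := (2 * b t - a') / (2 * (a t + 2 * t * b t))
    let N : ℝ := (a t * b' - 2 * a' * b t) / (2 * a t * (a t + 2 * t * b t))
    nablaA YH u (XH u) = horizontalLift nabla u (nabla Y p (X p))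
        - (1 / 2 : ℝ) • verticalLift u (R (X p) (Y p) u.snd) ∧
    nablaA YV u (XH u) = verticalLift u (nabla Y p (X p))
        + (a t / 2) • horizontalLift nabla u (R u.snd (Y p) (X p)) ∧
    nablaA YH u (XV u) = (a t / 2) • horizontalLift nabla u (R u.snd (X p) (Y p)) ∧
    nablaA YV u (XV u) = L • (gp (X p) u.snd • YV u + gp (Y p) u.snd • XV u)
        + (M' * gp (X p) (Y p)) • verticalLift u u.snd
        + (N * gp (X p) u.snd * gp (Y p) u.snd) • verticalLift u u.snd := by
  intro XH XV YH YV p gp R t a' b' L M' N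
  have hXH := isLiftSum_horizontalLift (cov := nabla) hX
  have hYH := isLiftSum_horizontalLift (cov := nabla) hY
  have hXV := isLiftSum_verticalLift (cov := nabla) hX
  have hYV := isLiftSum_verticalLift (cov := nabla) hY
  have hz := CovariantDerivative.zero_field_apply (cov := nabla) p
  have hR1 := hnabla.curvature_zero_left p
  have hR2 := hnabla.curvature_zero_middle p
  have hR3 := hnabla.curvature_zero_right p
  -- In each case one component of either argument is the zero field; `e1` and `e2` simplify the
  -- horizontal and the vertical part of the general formula.
  refine ⟨?_, ?_, ?_, ?_⟩
  · refine (hXH.leviCivita_gA hYH hnabla ha hb ha_pos hab_pos hnablaA u).trans ?_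
    have e1 : nabla Y p (X p)
        + (a t / 2) • (R u.snd 0 (X p) + R u.snd 0 (Y p)) = nabla Y p (X p) := by
      simp only [R, hR2, add_zero, smul_zero]
    have e2 : nabla (fun _ => 0) p (X p) - (1 / 2 : ℝ) • R (X p) (Y p) u.snd
        + L • (gp 0 u.snd • (0 : TangentSpace I p) + gp 0 u.snd • (0 : TangentSpace I p))
        + (M' * gp 0 0 + N * gp 0 u.snd * gp 0 u.snd) • u.snd
        = (-(1 / 2) : ℝ) • R (X p) (Y p) u.snd := by
      simp [hz]
    refine (congrArg₂ (fun x y => horizontalLift nabla u x + verticalLift u y) e1 e2).trans ?_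
    rw [verticalLift_smul, sub_eq_add_neg]
    exact congrArg _ (neg_smul (M := E × E) _ _)
  · refine (hXH.leviCivita_gA hYV hnabla ha hb ha_pos hab_pos hnablaA u).trans ?_
    have e1 : nabla (fun _ => 0) p (X p)
        + (a t / 2) • (R u.snd (Y p) (X p) + R u.snd 0 0) =
          (a t / 2) • R u.snd (Y p) (X p) := by
      simp only [R, hR2, add_zero, hz, zero_add]
    have e2 : nabla Y p (X p) - (1 / 2 : ℝ) • R (X p) 0 u.snd
        + L • (gp 0 u.snd • Y p + gp (Y p) u.snd • (0 : TangentSpace I p))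
        + (M' * gp 0 (Y p) + N * gp 0 u.snd * gp (Y p) u.snd) • u.snd
        = nabla Y p (X p) := by
      simp [R, hR2]
    refine (congrArg₂ (fun x y => horizontalLift nabla u x + verticalLift u y) e1 e2).trans ?_
    rw [horizontalLift_smul, add_comm]
  · refine (hXV.leviCivita_gA hYH hnabla ha hb ha_pos hab_pos hnablaA u).trans ?_
    have e1 : nabla Y p 0
        + (a t / 2) • (R u.snd 0 0 + R u.snd (X p) (Y p)) =
          (a t / 2) • R u.snd (X p) (Y p) := by
      simp only [R, hR2, map_zero, zero_add]
    have e2 : nabla (fun _ => 0) p 0 - (1 / 2 : ℝ) • R 0 (Y p) u.snd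
        + L • (gp (X p) u.snd • (0 : TangentSpace I p) + gp 0 u.snd • X p)
        + (M' * gp (X p) 0 + N * gp (X p) u.snd * gp 0 u.snd) • u.snd = 0 := by
      simp [R, hR1]
    refine (congrArg₂ (fun x y => horizontalLift nabla u x + verticalLift u y) e1 e2).trans ?_
    rw [horizontalLift_smul, verticalLift_zero, add_zero]
  · refine (hXV.leviCivita_gA hYV hnabla ha hb ha_pos hab_pos hnablaA u).trans ?_
    have e1 : nabla (fun _ => 0) p 0
        + (a t / 2) • (R u.snd (Y p) 0 + R u.snd (X p) 0) = 0 := by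
      simp only [R, hR3, map_zero, add_zero, smul_zero]
    have e2 : nabla Y p 0 - (1 / 2 : ℝ) • R 0 0 u.snd
        + L • (gp (X p) u.snd • Y p + gp (Y p) u.snd • X p)
        + (M' * gp (X p) (Y p) + N * gp (X p) u.snd * gp (Y p) u.snd) • u.snd =
        L • (gp (X p) u.snd • Y p + gp (Y p) u.snd • X p)
        + ((M' * gp (X p) (Y p)) • u.snd + (N * gp (X p) u.snd * gp (Y p) u.snd) • u.snd) := by
      simp only [R, hR1, map_zero, smul_zero, sub_zero, zero_add, add_smul]
    refine (congrArg₂ (fun x y => horizontalLift nabla u x + verticalLift u y) e1 e2).trans ?_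
    rw [horizontalLift_zero, zero_add]
    have e3 : verticalLift u (L • (gp (X p) u.snd • Y p + gp (Y p) u.snd • X p)) =
        L • (gp (X p) u.snd • YV u + gp (Y p) u.snd • XV u) := by
      refine (verticalLift_smul u _ _).trans (congrArg (L • ·) ?_)
      refine (verticalLift_add u _ _).trans ?_
      exact congrArg₂ (· + ·) (verticalLift_smul u _ _) (verticalLift_smul u _ _)
    have e4 (c d : ℝ) : verticalLift u (c • u.snd + d • u.snd) =
        c • verticalLift u u.snd + d • verticalLift u u.snd :=
      (verticalLift_add u _ _).trans
        (congrArg₂ (· + ·) (verticalLift_smul u _ _) (verticalLift_smul u _ _))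
    refine (verticalLift_add u _ _).trans ((congrArg₂ (· + ·) e3 (e4 _ _)).trans ?_)
    exact (add_assoc (G := E × E) _ _ _).symm
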